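/- Let $\mathcal S_n$ be the set of permutations of $[n]=\{1,\dots,n\}$. For $\sigma\in\mathcal S_n$ and $j\in[n]$ put $\mathrm{Inv}_j(\sigma)=|\{i<j:\sigma(i)>\sigma(j)\}|$ and $\mathrm{Inv}(\sigma)=|\{(i,j):i<j,\ \sigma(i)>\sigma(j)\}|$. For $q\in[0,\infty)$ let $\pi_{n,q}$ be the Mallows distribution on $\mathcal S_n$, $\pi_{n,q}(\sigma)=q^{\mathrm{Inv}(\sigma)}/Z_{n,q}$ with $Z_{n,q}=\prod_{k=1}^n\sum_{\ell=0}^{k-1}q^\ell$. A Mallows process is an $\mathcal S_n$-valued càdlàg stochastic process $(\mathcal M_t)_{t\in[0,\infty)}$ such that $\mathcal M_t$ has law $\pi_{n,t}$ for every $t\ge 0$. It is - monotone if almost surely $\mathrm{Inv}(\mathcal M_t)\le\mathrm{Inv}(\mathcal M_{t'})$ for all $t<t'$; - strongly monotone if moreover almost surely $\mathrm{Inv}_j(\mathcal M_t)\le\mathrm{Inv}_j(\mathcal M_{t'})$ for all $j\in[n]$ and $t<t'$; - smooth if it is strongly monotone and almost surely $\mathrm{Inv}(\mathcal M_t)\le\mathrm{Inv}(\mathcal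 M_{t-})+1$ for all $t$; - regular if it is smooth and the processes $(\mathrm{Inv}_j(\mathcal M_t))_{t\in[0,\infty)}$, $j\in[n]$, are independent. For each $n$, let $(\mathcal M^n_t)_{t\in[0,\infty)}$ be a monotone Mallows process on $\mathcal S_n$ (the processes for different $n$ may live on different probability spaces), with jumping times $$T_k=T^n_k=\inf\{t\in[0,\infty):\mathrm{Inv}(\mathcal M^n_t)\ge k\},\qquad 1\le k\le\tbinom n2 .$$ Then for every fixed integer $k\ge1$, as $n\to\infty$, $$nT_k\ \overset{d}{\longrightarrow}\ \mathrm{Gamma}(k,1)$$ (shape $k$, rate $1$). Moreover, if $\mathcal M^n$ is regular for every $n$, then $$(nT_1,\dots,nT_k)\ \overset{d}{\longrightarrow}\ \mathrm{PP}_k(1),$$ where $\mathrm{PP}_k(1)$ is the joint distribution of the first $k$ points, in increasing order, of a homogeneous Poisson point process with rate $1$ on $[0,\infty)$. -/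

import Mathlib

open MeasureTheory ProbabilityTheory Filter Topology
open scoped NNReal ENNReal

namespace Mallows

/-- The finite set of permutations of `{1, …, n}` carries the discrete topology. -/
instance permTopologicalSpace (n : ℕ) : TopologicalSpace (Equiv.Perm (Fin n)) := ⊥

instance permDiscreteTopology (n : ℕ) : DiscreteTopology (Equiv.Perm (Fin n)) := ⟨rfl⟩

/-- The finite set of permutations of `{1, …, n}` carries the discrete σ-algebra. -/
instance permMeasurableSpace (n : ℕ) : MeasurableSpace (Equiv.Perm (Fin n)) := ⊤

instance permDiscreteMeasurableSpace (n : ℕ) :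
    DiscreteMeasurableSpace (Equiv.Perm (Fin n)) := ⟨fun _ => trivial⟩

/-- `Inv_j(σ)`: the number of `i < j` with `σ(i) > σ(j)`. -/
def invAt {n : ℕ} (j : Fin n) (σ : Equiv.Perm (Fin n)) : ℕ :=
  (Finset.univ.filter fun i : Fin n => i < j ∧ σ j < σ i).card

/-- `Inv(σ)`: the number of pairs `i < j` with `σ(i) > σ(j)`. -/
def inv {n : ℕ} (σ : Equiv.Perm (Fin n)) : ℕ :=
  (Finset.univ.filter fun p : Fin n × Fin n => p.1 < p.2 ∧ σ p.2 < σ p.1).card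

/-- The normalizing constant `Z_{n,q} = ∏_{k=1}^n ∑_{ℓ=0}^{k-1} q^ℓ`. -/
noncomputable def Z (n : ℕ) (q : ℝ≥0) : ℝ≥0 :=
  ∏ k ∈ Finset.Icc 1 n, ∑ l ∈ Finset.range k, q ^ l

/-- The Mallows distribution `π_{n,q}`, with mass `q^{Inv(σ)} / Z_{n,q}` at each `σ`. -/
noncomputable def mallowsMeasure (n : ℕ) (q : ℝ≥0) : Measure (Equiv.Perm (Fin n)) :=
  Measure.sum fun σ => ((q ^ inv σ / Z n q : ℝ≥0) : ℝ≥0∞) • Measure.dirac σ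

/-- A path indexed by `[0,∞)` is càdlàg: right-continuous everywhere, with left limits at every
`t > 0`. -/
def IsCadlag {E : Type*} [TopologicalSpace E] (f : ℝ≥0 → E) : Prop :=
  (∀ t, ContinuousWithinAt f (Set.Ioi t) t) ∧ ∀ t, 0 < t → ∃ x, Tendsto f (𝓝[<] t) (𝓝 x)

section RandomObjects

variable {Ω : Type*} [MeasurableSpace Ω] {n : ℕ}

/-- Mallows process: a permutation-valued stochastic process with (almost surely) càdlàg paths
whose value at time `t` has law `π_{n,t}`. -/
structure IsMallowsProcess (M : ℝ≥0 → Ω → Equiv.Perm (Fin n)) (P : Measure Ω) : Prop where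
  measurable : ∀ t, Measurable (M t)
  cadlag : ∀ᵐ ω ∂P, IsCadlag fun t => M t ω
  law : ∀ t, P.map (M t) = mallowsMeasure n t

/-- Monotone Mallows process: almost surely `Inv(M_s) ≤ Inv(M_t)` for all `s < t`. -/
structure IsMonotone (M : ℝ≥0 → Ω → Equiv.Perm (Fin n)) (P : Measure Ω) : Prop
    extends IsMallowsProcess M P where
  inv_le : ∀ᵐ ω ∂P, ∀ s t, s < t → inv (M s ω) ≤ inv (M t ω)

/-- Strongly monotone Mallows process: moreover almost surely `Inv_j(M_s) ≤ Inv_j(M_t)` for all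
`j` and all `s < t`. -/
structure IsStronglyMonotone (M : ℝ≥0 → Ω → Equiv.Perm (Fin n)) (P : Measure Ω) : Prop
    extends IsMonotone M P where
  invAt_le : ∀ᵐ ω ∂P, ∀ j s t, s < t → invAt j (M s ω) ≤ invAt j (M t ω)

/-- Smooth Mallows process: strongly monotone, and almost surely `Inv(M_t) ≤ Inv(M_{t-}) + 1`
for all `t`. Here `Function.leftLim` is the left limit `M_{t-}`, with `M_{0-} = M_0`. -/
structure IsSmooth (M : ℝ≥0 → Ω → Equiv.Perm (Fin n)) (P : Measure Ω) : Prop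
    extends IsStronglyMonotone M P where
  inv_le_leftLim : ∀ᵐ ω ∂P, ∀ t,
    inv (M t ω) ≤ inv (Function.leftLim (fun s => M s ω) t) + 1

/-- Regular Mallows process: smooth, and the processes `(Inv_j(M_t))_{t ≥ 0}`, as random elements
of the path space `ℝ≥0 → ℕ` with its product σ-algebra, are independent over `j`. -/
structure IsRegular (M : ℝ≥0 → Ω → Equiv.Perm (Fin n)) (P : Measure Ω) : Prop
    extends IsSmooth M P where
  indep : iIndepFun (fun (j : Fin n) (ω : Ω) (t : ℝ≥0) => invAt j (M t ω)) P

/-- The jumping time `T_k = inf {t ≥ 0 : Inv(M_t) ≥ k}`. For `k ≤ n(n-1)/2` and a Mallows process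
the set is almost surely nonempty; where it is empty, the value is `0`. -/
noncomputable def jumpTime (M : ℝ≥0 → Ω → Equiv.Perm (Fin n)) (k : ℕ) (ω : Ω) : ℝ :=
  ((sInf {t : ℝ≥0 | k ≤ inv (M t ω)} : ℝ≥0) : ℝ)

/-- Homogeneous Poisson point process on `[0,∞)` with rate `lam`: a random subset `N` of `[0,∞)`
such that the number of points in a Borel set `B ⊆ [0,∞)` of finite Lebesgue measure `|B|` is
Poisson distributed with parameter `lam * |B|`, and the numbers of points in pairwise disjoint
Borel sets are independent. -/
structure IsPoissonPointProcess (N : Ω → Set ℝ) (lam : ℝ≥0) (P : Measure Ω) : Prop where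
  subset : ∀ ω, N ω ⊆ Set.Ici 0
  measurable : ∀ B : Set ℝ, MeasurableSet B → Measurable fun ω => (N ω ∩ B).encard
  law : ∀ B : Set ℝ, MeasurableSet B → B ⊆ Set.Ici 0 → volume B ≠ ∞ → ∀ m : ℕ,
    P {ω | (N ω ∩ B).encard = m} = poissonMeasure (lam * (volume B).toNNReal) {m}
  indep : ∀ (m : ℕ) (B : Fin m → Set ℝ), (∀ i, MeasurableSet (B i)) →
    Pairwise (Function.onFun Disjoint B) → iIndepFun (fun i ω => (N ω ∩ B i).encard) P

end RandomObjects

/-- The `i`-th smallest point (`i = 1, 2, …`) of a subset `S` of `[0,∞)` that is infinite and has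
finitely many points in each bounded interval. -/
noncomputable def nthPoint (S : Set ℝ) (i : ℕ) : ℝ :=
  sInf {t : ℝ | 0 ≤ t ∧ (i : ℕ∞) ≤ (S ∩ Set.Icc 0 t).encard}

end Mallows

namespace Mallows

/-! ### The Lehmer code and the law of the inversion counts -/

section LehmerCode

variable {n : ℕ}

/-! The Lehmer code `σ ↦ (invAt j σ)_j` is a bijection onto `∏_j {0,…,j}`, and its entries add up to
`inv σ`. Hence the Mallows weight factors, and under `mallowsMeasure n q` the `invAt j` are
independent truncated geometric variables (`mallowsMeasure_forall_invAt_mem`). At `q = x / n` each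
entry with `j ≠ 0` is positive with probability `x / n` up to `(x / n)²`, and exceeds one with
probability at most `(x / n)²`. So `inv` is nearly a sum of `n` independent rare indicators, and its
law tends to Poisson(`x`).

Since paths are monotone and right-continuous, almost surely `n T_k ≤ c` exactly when `k ≤ inv
(M_{c/n})`. The law of a single `T_k` therefore depends only on the one-time marginals, not on the
coupling between times, and `P(Poisson(c) ≥ k)` is the Gamma(`k`, 1) distribution function
(`poissonMeasure_Ici_eq_gammaMeasure`).

In the regular case the increments of `inv` over a grid `t l / n` form a sum over `j` of independent
vectors, each mostly zero and otherwise mostly a unit vector, the `l`-th with probability about `(t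
(l + 1) - t l) / n`. Characteristic functions show that the sum converges to independent Poisson
variables (`tendsto_measure_increments`). These are the increments of the counting process of the
Poisson point process, and events `a i < n T_i ≤ b i` are events about finitely many increments, so
the limit passes to the hitting times (`tendstoInDistribution_of_increments`). -/

lemma inv_eq_sum_invAt (σ : Equiv.Perm (Fin n)) : inv σ = ∑ j, invAt j σ := by
  classical
  unfold inv invAt
  rw [← Finset.card_sigma]
  refine Finset.card_bij (fun p _ => ⟨p.2, p.1⟩) ?_ ?_ ?_
  · intro p hp
    simpa using hp
  · rintro ⟨a, b⟩ _ ⟨c, d⟩ _ h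
    simp only [Sigma.mk.injEq, heq_eq_eq] at h
    exact Prod.ext h.2 h.1
  · rintro ⟨b, a⟩ h
    exact ⟨(a, b), by simpa using h, rfl⟩

lemma invAt_le (j : Fin n) (σ : Equiv.Perm (Fin n)) : invAt j σ ≤ j := by
  unfold invAt
  calc _ ≤ (Finset.Iio j).card :=
        Finset.card_le_card fun i hi => by simp at hi ⊢; exact hi.1
    _ = j := Fin.card_Iio j

/-- The number of inversions ending at `j` counts the values larger than `σ j` that are not taken
at positions after `j`. -/
lemma invAt_eq_card_values (j : Fin n) (σ : Equiv.Perm (Fin n)) :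
    invAt j σ = (Finset.univ.filter fun v => σ j < v ∧ ∀ i, j < i → σ i ≠ v).card := by
  unfold invAt
  refine Finset.card_bij (fun i _ => σ i) ?_ (fun a _ b _ h => σ.injective h) ?_
  · intro i hi
    simp only [Finset.mem_filter, Finset.mem_univ, true_and] at hi ⊢
    refine ⟨hi.2, fun i' hi' h => ?_⟩
    have := σ.injective h
    subst this
    exact absurd hi.1 hi'.not_gt
  · intro v hv
    simp only [Finset.mem_filter, Finset.mem_univ, true_and] at hv
    refine ⟨σ.symm v, ?_, by simp⟩
    simp only [Finset.mem_filter, Finset.mem_univ, true_and, Equiv.apply_symm_apply]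
    refine ⟨lt_of_le_of_ne (not_lt.1 fun h => hv.2 _ h (by simp)) fun h => ?_, hv.1⟩
    have := hv.1
    rw [← h] at this
    simp at this

/-- Decode from the last position backwards: once the values after `j` are known, the number of
unused values above `σ j` strictly decreases in `σ j`, so the count determines `σ j`. -/
lemma lehmerCode_injective :
    Function.Injective fun (σ : Equiv.Perm (Fin n)) (j : Fin n) => invAt j σ := by
  intro σ τ h
  have key : ∀ m : ℕ, ∀ j : Fin n, n - 1 - j = m → σ j = τ j := by
    intro m
    induction m using Nat.strong_induction_on with
    | _ m ih =>
      intro j hj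
      have hgt : ∀ i, j < i → σ i = τ i := by
        intro i hi
        exact ih (n - 1 - i) (by have := i.2; have : (j : ℕ) < i := hi; omega) i rfl
      have hcard := congrFun h j
      simp only [invAt_eq_card_values] at hcard
      have aux : ∀ ρ π : Equiv.Perm (Fin n), (∀ i, j < i → ρ i = π i) → ρ j < π j →
          (Finset.univ.filter fun v => π j < v ∧ ∀ i, j < i → π i ≠ v).card <
            (Finset.univ.filter fun v => ρ j < v ∧ ∀ i, j < i → ρ i ≠ v).card := by
        intro ρ π hρπ hlt
        refine Finset.card_lt_card ((Finset.ssubset_iff_of_subset ?_).2 ⟨π j, ?_, ?_⟩)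
        · intro v hv
          simp only [Finset.mem_filter, Finset.mem_univ, true_and] at hv ⊢
          exact ⟨hlt.trans hv.1, fun i hi => (hρπ i hi) ▸ hv.2 i hi⟩
        · simp only [Finset.mem_filter, Finset.mem_univ, true_and]
          refine ⟨hlt, fun i hi => ?_⟩
          rw [hρπ i hi]
          exact fun e => hi.ne' (π.injective e)
        · simp
      rcases lt_trichotomy (σ j) (τ j) with hlt | heq | hlt
      · exact absurd hcard (aux σ τ hgt hlt).ne'
      · exact heq
      · exact absurd hcard (aux τ σ (fun i hi => (hgt i hi).symm) hlt).ne
  exact Equiv.ext fun j => key _ j rfl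

/-- An injection between two sets of cardinality `n!` is onto. -/
lemma image_lehmerCode :
    Finset.univ.image (fun (σ : Equiv.Perm (Fin n)) (j : Fin n) => invAt j σ) =
      Fintype.piFinset fun j : Fin n => Finset.range (j + 1) := by
  refine Finset.eq_of_subset_of_card_le ?_ ?_
  · intro f hf
    obtain ⟨σ, -, rfl⟩ := Finset.mem_image.1 hf
    simpa [Nat.lt_succ_iff] using fun j => invAt_le j σ
  · rw [Finset.card_image_of_injective _ lehmerCode_injective, Fintype.card_piFinset,
      Finset.card_univ, Fintype.card_perm, Fintype.card_fin]
    simp only [Finset.card_range]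
    rw [Fin.prod_univ_eq_prod_range (fun i => i + 1), Finset.prod_range_add_one_eq_factorial]

/-- This factorization of sums over permutations is the source of all independence below. -/
lemma sum_prod_invAt {R : Type*} [CommSemiring R] (f : Fin n → ℕ → R) :
    ∑ σ : Equiv.Perm (Fin n), ∏ j, f j (invAt j σ) =
      ∏ j : Fin n, ∑ l ∈ Finset.range ((j : ℕ) + 1), f j l := by
  rw [Finset.prod_univ_sum, ← image_lehmerCode, Finset.sum_image]
  exact fun _ _ _ _ h => lehmerCode_injective h

/-- The geometric sum `1 + q + ⋯ + q ^ j`. -/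
noncomputable def geomSum (j : ℕ) (q : ℝ≥0) : ℝ≥0 := ∑ l ∈ Finset.range (j + 1), q ^ l

lemma geomSum_succ (j : ℕ) (q : ℝ≥0) : geomSum (j + 1) q = 1 + q * geomSum j q := by
  unfold geomSum
  rw [Finset.sum_range_succ', Finset.mul_sum, add_comm]
  simp [pow_succ']

lemma one_le_geomSum (j : ℕ) (q : ℝ≥0) : 1 ≤ geomSum j q := by
  unfold geomSum
  rw [Finset.sum_range_succ']
  simp

lemma geomSum_ne_zero (j : ℕ) (q : ℝ≥0) : geomSum j q ≠ 0 :=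
  (zero_lt_one.trans_le (one_le_geomSum j q)).ne'

lemma Z_eq_prod_geomSum (n : ℕ) (q : ℝ≥0) : Z n q = ∏ j : Fin n, geomSum j q := by
  unfold Z geomSum
  rw [Fin.prod_univ_eq_prod_range (fun j => ∑ l ∈ Finset.range (j + 1), q ^ l),
    Finset.range_eq_Ico, Finset.prod_Ico_add' (fun k => ∑ l ∈ Finset.range k, q ^ l) 0 n 1]
  rfl

open Classical in
lemma mallowsMeasure_apply (n : ℕ) (q : ℝ≥0) (A : Set (Equiv.Perm (Fin n))) :
    mallowsMeasure n q A = ((∑ σ, if σ ∈ A then q ^ inv σ / Z n q else 0 : ℝ≥0) : ℝ≥0∞) := by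
  rw [mallowsMeasure, Measure.sum_apply _ .of_discrete, tsum_fintype, ENNReal.ofNNReal_finsetSum]
  refine Finset.sum_congr rfl fun σ _ => ?_
  rw [Measure.smul_apply, Measure.dirac_apply, Set.indicator_apply]
  split_ifs <;> simp

open Classical in
/-- Under the Mallows distribution, the inversion counts `Inv_j` are independent with truncated
geometric laws. -/
lemma mallowsMeasure_forall_invAt_mem (n : ℕ) (q : ℝ≥0) (A : Fin n → Set ℕ) :
    mallowsMeasure n q {σ | ∀ j, invAt j σ ∈ A j} =
      ∏ j : Fin n, (((∑ l ∈ Finset.range ((j : ℕ) + 1), if l ∈ A j then q ^ l else 0) /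
        geomSum j q : ℝ≥0) : ℝ≥0∞) := by
  rw [mallowsMeasure_apply, ← ENNReal.ofNNReal_finsetProd, Finset.prod_div_distrib,
    ← Z_eq_prod_geomSum, ← sum_prod_invAt (fun j l => if l ∈ A j then q ^ l else 0),
    Finset.sum_div]
  congr 1
  refine Finset.sum_congr rfl fun σ _ => ?_
  by_cases h : ∀ j, invAt j σ ∈ A j
  · simp [h, inv_eq_sum_invAt, Finset.prod_pow_eq_pow_sum]
  · rw [if_neg (by simpa using h)]
    push Not at h
    obtain ⟨j, hj⟩ := h
    rw [Finset.prod_eq_zero (Finset.mem_univ j) (by simp [hj]), zero_div]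

open Classical in
lemma mallowsMeasure_invAt_mem (q : ℝ≥0) (j : Fin n) (A : Set ℕ) :
    mallowsMeasure n q {σ | invAt j σ ∈ A} =
      (((∑ l ∈ Finset.range ((j : ℕ) + 1), if l ∈ A then q ^ l else 0) /
        geomSum j q : ℝ≥0) : ℝ≥0∞) := by
  have h := mallowsMeasure_forall_invAt_mem n q (fun i => if i = j then A else Set.univ)
  have hset : {σ : Equiv.Perm (Fin n) | ∀ i, invAt i σ ∈ (if i = j then A else Set.univ)} =
      {σ | invAt j σ ∈ A} := by
    ext σ
    constructor
    · intro h
      simpa using h j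
    · intro h i
      by_cases hi : i = j
      · subst hi; simpa using h
      · simp [hi]
  rw [hset] at h
  rw [h, Finset.prod_eq_single j]
  · simp
  · intro i _ hi
    simp only [hi, if_false, Set.mem_univ, if_true]
    rw [← geomSum, div_self (geomSum_ne_zero _ _), ENNReal.coe_one]
  · simp

instance mallowsMeasure.isProbabilityMeasure (n : ℕ) (q : ℝ≥0) :
    IsProbabilityMeasure (mallowsMeasure n q) where
  measure_univ := by
    have h := mallowsMeasure_forall_invAt_mem n q (fun _ => Set.univ)
    simp only [Set.mem_univ, implies_true, Set.ofPred_true, if_true] at h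
    rw [h]
    refine Finset.prod_eq_one fun j _ => ?_
    rw [← geomSum, div_self (geomSum_ne_zero _ _), ENNReal.coe_one]

lemma iIndepFun_invAt (n : ℕ) (q : ℝ≥0) :
    iIndepFun (fun j : Fin n => invAt j) (mallowsMeasure n q) := by
  classical
  rw [iIndepFun_iff_measure_inter_preimage_eq_mul]
  intro S A _
  have h := mallowsMeasure_forall_invAt_mem n q (fun i => if i ∈ S then A i else Set.univ)
  have hset : {σ : Equiv.Perm (Fin n) | ∀ i, invAt i σ ∈ (if i ∈ S then A i else Set.univ)} =
      ⋂ i ∈ S, invAt i ⁻¹' A i := by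
    ext σ
    simp only [Set.mem_ofPred_eq, Set.mem_iInter, Set.mem_preimage]
    refine forall_congr' fun i => ?_
    by_cases hi : i ∈ S <;> simp [hi]
  rw [hset] at h
  rw [h, ← Finset.prod_subset (Finset.subset_univ S)]
  · refine Finset.prod_congr rfl fun i hi => ?_
    simp only [hi, if_true]
    exact (mallowsMeasure_invAt_mem q i (A i)).symm
  · intro i _ hi
    simp only [hi, if_false, Set.mem_univ, if_true]
    rw [← geomSum, div_self (geomSum_ne_zero _ _), ENNReal.coe_one]

/-- The mass of `{Inv_j ≥ a}` is at most `q ^ a`. -/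
lemma mallowsMeasure_le_invAt (q : ℝ≥0) (j : Fin n) (a : ℕ) :
    (mallowsMeasure n q).real {σ | a ≤ invAt j σ} ≤ (q : ℝ) ^ a := by
  classical
  have h := mallowsMeasure_invAt_mem q j (Set.Ici a)
  simp only [Set.mem_Ici] at h
  rw [measureReal_def, h, ENNReal.coe_toReal, ← NNReal.coe_pow, NNReal.coe_le_coe]
  refine div_le_of_le_mul₀ zero_le zero_le ?_
  rw [← Finset.sum_filter, geomSum, Finset.mul_sum]
  calc _ ≤ ∑ l ∈ (Finset.range ((j : ℕ) + 1)).image (fun l => a + l), q ^ l := by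
        refine Finset.sum_le_sum_of_subset fun l hl => ?_
        simp only [Finset.mem_filter, Finset.mem_range, Finset.mem_image] at hl ⊢
        exact ⟨l - a, by omega, by omega⟩
    _ = _ := by
        rw [Finset.sum_image (by intro a _ b _ h; simpa using h)]
        exact Finset.sum_congr rfl fun l _ => pow_add _ _ _

/-- The complementary probability is `1 / geomSum j q ≤ 1 / (1 + q) ≤ 1 - q + q ^ 2`. The case `j =
0` is excluded because `invAt 0` vanishes identically. -/
lemma mallowsMeasure_invAt_pos (q : ℝ≥0) (j : Fin n) (hj : (j : ℕ) ≠ 0) :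
    (q : ℝ) - q ^ 2 ≤ (mallowsMeasure n q).real {σ | 1 ≤ invAt j σ} := by
  classical
  have h := mallowsMeasure_invAt_mem q j {0}
  have hc : {σ : Equiv.Perm (Fin n) | 1 ≤ invAt j σ} = {σ | invAt j σ ∈ ({0} : Set ℕ)}ᶜ := by
    ext σ
    simp [Nat.one_le_iff_ne_zero]
  rw [hc, probReal_compl_eq_one_sub .of_discrete, measureReal_def, h, ENNReal.coe_toReal]
  rw [Finset.sum_eq_single 0 (by simp +contextual) (by simp), if_pos (Set.mem_singleton 0), pow_zero]
  obtain ⟨i, hi⟩ := Nat.exists_eq_succ_of_ne_zero hj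
  have h1 : (1 : ℝ) + q ≤ geomSum j q := by
    rw [hi, Nat.succ_eq_add_one, geomSum_succ]
    push_cast
    have : (1 : ℝ) ≤ geomSum i q := by exact_mod_cast one_le_geomSum i q
    nlinarith [q.2]
  have hq : (0 : ℝ) ≤ q := q.2
  have h2 : ((1 / geomSum j q : ℝ≥0) : ℝ) ≤ 1 / (1 + q) := by
    push_cast
    exact one_div_le_one_div_of_le (by positivity) h1
  have h3 : 1 / (1 + (q : ℝ)) ≤ 1 - q + q ^ 2 := by
    rw [div_le_iff₀ (by positivity)]
    nlinarith [pow_nonneg hq 3]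
  linarith

/-- As `q` grows the mass concentrates on the maximal value `j`; this gives that every level below
`n` is reached almost surely. -/
lemma mallowsMeasure_invAt_lt (q : ℝ≥0) (hq : 0 < q) (j : Fin n) :
    (mallowsMeasure n q).real {σ | invAt j σ < j} ≤ 1 / (q : ℝ) := by
  classical
  have h := mallowsMeasure_invAt_mem q j (Set.Iio (j : ℕ))
  simp only [Set.mem_Iio] at h
  rw [measureReal_def, h, ENNReal.coe_toReal, ← NNReal.coe_one, ← NNReal.coe_div,
    NNReal.coe_le_coe, div_le_div_iff₀ (one_le_geomSum _ _ |> zero_lt_one.trans_le) hq, one_mul]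
  rw [Finset.sum_range_succ, if_neg (lt_irrefl _), add_zero, Finset.sum_congr rfl
    (fun l hl => if_pos (Finset.mem_range.1 hl)), geomSum, Finset.sum_range_succ', Finset.sum_mul]
  simp [pow_succ]

end LehmerCode

/-! ### Poisson limits for triangular arrays -/

section PoissonLimit

/-- Factors are exchanged one at a time, the others having norm at most one. -/
lemma norm_prod_sub_prod_le {ι : Type*} (s : Finset ι) (a b : ι → ℂ)
    (ha : ∀ i ∈ s, ‖a i‖ ≤ 1) (hb : ∀ i ∈ s, ‖b i‖ ≤ 1) :
    ‖∏ i ∈ s, a i - ∏ i ∈ s, b i‖ ≤ ∑ i ∈ s, ‖a i - b i‖ := by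
  classical
  induction s using Finset.induction_on with
  | empty => simp
  | insert i s hi ih =>
    rw [Finset.prod_insert hi, Finset.prod_insert hi, Finset.sum_insert hi]
    have h1 : ‖∏ i ∈ s, b i‖ ≤ 1 := by
      rw [norm_prod]
      exact Finset.prod_le_one (fun _ _ => norm_nonneg _)
        fun j hj => hb j (Finset.mem_insert_of_mem hj)
    have h2 := ih (fun j hj => ha j (Finset.mem_insert_of_mem hj))
      fun j hj => hb j (Finset.mem_insert_of_mem hj)
    have h3 := ha i (Finset.mem_insert_self i s)
    calc ‖a i * ∏ i ∈ s, a i - b i * ∏ i ∈ s, b i‖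
        = ‖a i * (∏ i ∈ s, a i - ∏ i ∈ s, b i) + (a i - b i) * ∏ i ∈ s, b i‖ := by ring_nf
      _ ≤ ‖a i‖ * ‖∏ i ∈ s, a i - ∏ i ∈ s, b i‖ + ‖a i - b i‖ * ‖∏ i ∈ s, b i‖ := by
          rw [← norm_mul, ← norm_mul]
          exact norm_add_le _ _
      _ ≤ 1 * (∑ i ∈ s, ‖a i - b i‖) + ‖a i - b i‖ * 1 := by gcongr
      _ = _ := by ring

/-- If the characteristic functions of random integer vectors converge, then so do the
probabilities of all events. -/
lemma tendsto_measure_of_tendsto_charFun_int {ι : Type*} [Fintype ι] {Ω : ℕ → Type*}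
    [∀ n, MeasurableSpace (Ω n)] (P : ∀ n, Measure (Ω n)) [∀ n, IsProbabilityMeasure (P n)]
    {Ω' : Type*} [MeasurableSpace Ω'] (P' : Measure Ω') [IsProbabilityMeasure P']
    (D : ∀ n, Ω n → ι → ℤ) (hD : ∀ n, Measurable (D n)) (D' : Ω' → ι → ℤ) (hD' : Measurable D')
    (h : ∀ θ : ι → ℝ, Tendsto
      (fun n => ∫ ω, Complex.exp ((∑ l, D n ω l * θ l : ℝ) * Complex.I) ∂P n) atTop
      (𝓝 (∫ ω, Complex.exp ((∑ l, D' ω l * θ l : ℝ) * Complex.I) ∂P')))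
    (A : Set (ι → ℤ)) : Tendsto (fun n => P n (D n ⁻¹' A)) atTop (𝓝 (P' (D' ⁻¹' A))) := by
  let e : (ι → ℤ) → EuclideanSpace ℝ ι := fun d => WithLp.toLp 2 fun l => (d l : ℝ)
  have he : Measurable e := by
    refine (MeasurableEquiv.toLp 2 (ι → ℝ)).measurable.comp (measurable_pi_lambda _ fun l => ?_)
    exact (measurable_of_countable (fun z : ℤ => (z : ℝ))).comp (measurable_pi_apply l)
  let ν : ℕ → ProbabilityMeasure (EuclideanSpace ℝ ι) := fun n =>
    ⟨(P n).map (e ∘ D n), Measure.isProbabilityMeasure_map (he.comp (hD n)).aemeasurable⟩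
  let ν' : ProbabilityMeasure (EuclideanSpace ℝ ι) :=
    ⟨P'.map (e ∘ D'), Measure.isProbabilityMeasure_map (he.comp hD').aemeasurable⟩
  have hchar : ∀ (d : ι → ℤ) (θ : EuclideanSpace ℝ ι),
      inner ℝ (e d) θ = ∑ l, (d l : ℝ) * θ l := by
    intro d θ
    simp [e, PiLp.inner_apply, mul_comm]
  have hlim : Tendsto ν atTop (𝓝 ν') := by
    refine ProbabilityMeasure.tendsto_of_tendsto_charFun fun θ => ?_
    have h1 : ∀ n, charFun (ν n : Measure (EuclideanSpace ℝ ι)) θ =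
        ∫ ω, Complex.exp ((∑ l, D n ω l * θ l : ℝ) * Complex.I) ∂P n := by
      intro n
      simp only [ν, ProbabilityMeasure.coe_mk, charFun_apply]
      rw [integral_map (he.comp (hD n)).aemeasurable (by fun_prop)]
      simp only [Function.comp_apply, hchar]
    have h2 : charFun (ν' : Measure (EuclideanSpace ℝ ι)) θ =
        ∫ ω, Complex.exp ((∑ l, D' ω l * θ l : ℝ) * Complex.I) ∂P' := by
      simp only [ν', ProbabilityMeasure.coe_mk, charFun_apply]
      rw [integral_map (he.comp hD').aemeasurable (by fun_prop)]
      simp only [Function.comp_apply, hchar]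
    simp only [h1, h2]
    exact h θ
  -- Radius `1 / 2` makes the cubes around lattice points disjoint. The union of those centred in
  -- `A` then meets the lattice exactly in `A`, and its frontier misses the lattice, which carries
  -- the limit law; the portmanteau theorem applies.
  let c : (ι → ℤ) → Set (EuclideanSpace ℝ ι) := fun d => {x | ∀ l, |x l - d l| < 1 / 2}
  have hc : ∀ d, IsOpen (c d) := fun d => by
    have : c d = ⋂ l, {x : EuclideanSpace ℝ ι | |x l - d l| < 1 / 2} := by ext; simp [c]
    rw [this]
    exact isOpen_iInter_of_finite fun l => isOpen_lt (by fun_prop) continuous_const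
  have hcd : ∀ d b x, x ∈ c d → x ∈ c b → d = b := by
    intro d b x hd hb
    funext l
    have h1 := abs_lt.1 (hd l)
    have h2 := abs_lt.1 (hb l)
    have h3 : ((d l - b l : ℤ) : ℝ) < 1 := by push_cast; linarith
    have h4 : ((b l - d l : ℤ) : ℝ) < 1 := by push_cast; linarith
    have h5 : d l - b l < 1 := by exact_mod_cast h3
    have h6 : b l - d l < 1 := by exact_mod_cast h4
    omega
  have hself : ∀ d, e d ∈ c d := fun d l => by simp [e]
  let U : Set (EuclideanSpace ℝ ι) := ⋃ a ∈ A, c a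
  have hU : IsOpen U := isOpen_biUnion fun a _ => hc a
  have hpre : e ⁻¹' U = A := by
    ext d
    simp only [U, Set.mem_preimage, Set.mem_iUnion, exists_prop]
    exact ⟨fun ⟨a, ha, hda⟩ => hcd a d _ hda (hself d) ▸ ha, fun hd => ⟨d, hd, hself d⟩⟩
  have hfront : e ⁻¹' frontier U = ∅ := by
    refine Set.eq_empty_of_forall_notMem fun d hd => ?_
    rw [Set.mem_preimage, hU.frontier_eq] at hd
    obtain ⟨x, hx, hxU⟩ := mem_closure_iff.1 hd.1 (c d) (hc d) (hself d)
    simp only [U, Set.mem_iUnion, exists_prop] at hxU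
    obtain ⟨a, ha, hxa⟩ := hxU
    have := hcd a d x hxa hx
    subst this
    exact hd.2 (Set.mem_biUnion ha (hself a))
  have key := ProbabilityMeasure.tendsto_measure_of_null_frontier_of_tendsto' hlim (E := U) (by
    simp only [ν', ProbabilityMeasure.coe_mk]
    rw [Measure.map_apply (he.comp hD') isClosed_frontier.measurableSet, Set.preimage_comp,
      hfront, Set.preimage_empty, measure_empty])
  simp only [ν, ν', ProbabilityMeasure.coe_mk] at key
  rw [Measure.map_apply (he.comp hD') hU.measurableSet, Set.preimage_comp, hpre] at key
  refine key.congr fun n => ?_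
  rw [Measure.map_apply (he.comp (hD n)) hU.measurableSet, Set.preimage_comp, hpre]

/-- The characteristic function of independent Poisson variables. -/
lemma integral_exp_pi_poissonMeasure {ι : Type*} [Fintype ι] (r : ι → ℝ≥0) (θ : ι → ℝ) :
    ∫ x : ι → ℕ, Complex.exp ((∑ l, ((x l : ℤ) : ℝ) * θ l : ℝ) * Complex.I)
        ∂Measure.pi (fun l => poissonMeasure (r l)) =
      Complex.exp (∑ l, r l * (Complex.exp (θ l * Complex.I) - 1)) := by
  rw [Complex.exp_sum]
  have h : ∀ l, Complex.exp (r l * (Complex.exp (θ l * Complex.I) - 1)) =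
      ∫ a, Complex.exp ((a * θ l : ℝ) * Complex.I) ∂poissonMeasure (r l) := by
    intro l
    rw [← charFun_map_cast_poissonMeasure, charFun_apply, integral_map .of_discrete (by fun_prop)]
    simp only [Real.inner_apply]
  simp_rw [h]
  rw [← integral_fintype_prod_eq_prod]
  refine integral_congr_ae (ae_of_all _ fun x => ?_)
  beta_reduce
  rw [← Complex.exp_sum, ← Finset.sum_mul]
  push_cast
  rfl

/-- The character `θ` evaluated at the first `m` increments of the sequence `v`. -/
noncomputable def incrExp {m : ℕ} (θ : Fin m → ℝ) (v : ℕ → ℕ) : ℂ :=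
  Complex.exp ((∑ l : Fin m, ((((v (l + 1) : ℤ) - v l : ℤ)) : ℝ) * θ l : ℝ) * Complex.I)

lemma norm_incrExp {m : ℕ} (θ : Fin m → ℝ) (v : ℕ → ℕ) : ‖incrExp θ v‖ = 1 :=
  Complex.norm_exp_ofReal_mul_I _

lemma measurable_incrExp {m : ℕ} (θ : Fin m → ℝ) : Measurable (incrExp θ) := by
  unfold incrExp
  have h : ∀ l : ℕ, Measurable fun v : ℕ → ℕ => ((((v (l + 1) : ℤ) - v l : ℤ)) : ℝ) := by
    intro l
    have hp : Measurable fun v : ℕ → ℕ => (v (l + 1), v l) :=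
      (measurable_pi_apply _).prodMk (measurable_pi_apply _)
    exact (measurable_of_countable (fun x : ℕ × ℕ => (((x.1 : ℤ) - x.2 : ℤ) : ℝ))).comp hp
  have h' : Measurable fun v : ℕ → ℕ =>
      ∑ l : Fin m, ((((v (l + 1) : ℤ) - v l : ℤ)) : ℝ) * θ l :=
    Finset.measurable_sum _ fun l _ => (h l).mul_const _
  exact Complex.measurable_exp.comp ((Complex.measurable_ofReal.comp h').mul_const _)

lemma incrExp_sum {m : ℕ} (θ : Fin m → ℝ) {ι : Type*} (s : Finset ι) (v : ι → ℕ → ℕ) :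
    incrExp θ (fun l => ∑ j ∈ s, v j l) = ∏ j ∈ s, incrExp θ (v j) := by
  unfold incrExp
  rw [← Complex.exp_sum, ← Finset.sum_mul, ← Complex.ofReal_sum, Finset.sum_comm]
  congr 3
  refine Finset.sum_congr rfl fun l _ => ?_
  rw [← Finset.sum_mul]
  push_cast
  rw [Finset.sum_sub_distrib]

/-- For a nondecreasing sequence of naturals with at most one jump, `exp` of a linear combination of
the increments is affine in the indicators. -/
lemma norm_exp_increments_sub_le {m : ℕ} (θ : Fin m → ℝ) (v : ℕ → ℕ) (hv : Monotone v) :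
    ‖incrExp θ v - (1 + ∑ l : Fin m, (Complex.exp (θ l * Complex.I) - 1) *
        ((Set.indicator {a : ℕ | 1 ≤ a} 1 (v (l + 1)) - Set.indicator {a : ℕ | 1 ≤ a} 1 (v l) : ℝ)
          : ℂ))‖ ≤ (2 + 2 * m) * Set.indicator {a : ℕ | 2 ≤ a} (1 : ℕ → ℝ) (v m) := by
  have hexp : ∀ x : ℝ, ‖Complex.exp (x * Complex.I)‖ = 1 := Complex.norm_exp_ofReal_mul_I
  by_cases h2 : 2 ≤ v m
  -- Crude bound: the exponential and the constant contribute 1 each, and each of the `m` summands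
  -- at most 2.
  · rw [Set.indicator_of_mem (by exact h2), Pi.one_apply, mul_one]
    refine (norm_sub_le _ _).trans ?_
    rw [norm_incrExp]
    refine (add_le_add_right (norm_add_le _ _) _).trans ?_
    rw [norm_one]
    have : ‖∑ l : Fin m, (Complex.exp (θ l * Complex.I) - 1) *
        ((Set.indicator {a : ℕ | 1 ≤ a} 1 (v (l + 1)) - Set.indicator {a : ℕ | 1 ≤ a} 1 (v l) : ℝ)
          : ℂ)‖ ≤ ∑ l : Fin m, 2 := by
      refine norm_sum_le_of_le _ fun l _ => ?_
      rw [norm_mul, Complex.norm_real]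
      have h1 : ‖Complex.exp (θ l * Complex.I) - 1‖ ≤ 2 := by
        refine (norm_sub_le _ _).trans ?_
        rw [hexp, norm_one]; norm_num
      have h3 : ‖(Set.indicator {a : ℕ | 1 ≤ a} 1 (v (l + 1)) -
          Set.indicator {a : ℕ | 1 ≤ a} 1 (v l) : ℝ)‖ ≤ 1 := by
        simp only [Set.indicator_apply, Pi.one_apply]
        split_ifs <;> norm_num
      calc _ ≤ (2 : ℝ) * 1 := by gcongr
        _ = 2 := by ring
    simp only [Finset.sum_const, Finset.card_univ, Fintype.card_fin, nsmul_eq_mul] at this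
    linarith
  · rw [Set.indicator_of_notMem (by exact h2), mul_zero]
    refine le_of_eq (norm_eq_zero.2 (sub_eq_zero.2 ?_))
    unfold incrExp
    have hle : ∀ l : ℕ, l ≤ m → v l ≤ 1 := fun l hl => by have := hv hl; omega
    have hind : ∀ l : ℕ, l ≤ m → Set.indicator {a : ℕ | 1 ≤ a} (1 : ℕ → ℝ) (v l) = v l := by
      intro l hl
      have := hle l hl
      by_cases h : 1 ≤ v l
      · rw [Set.indicator_of_mem (by exact h), show v l = 1 by omega]; simp
      · rw [Set.indicator_of_notMem (by exact h), show v l = 0 by omega]; simp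
    have hind' : ∀ l : Fin m, (Set.indicator {a : ℕ | 1 ≤ a} (1 : ℕ → ℝ) (v (l + 1)) -
        Set.indicator {a : ℕ | 1 ≤ a} (1 : ℕ → ℝ) (v l) : ℝ) = (v (l + 1) : ℝ) - v l := by
      intro l
      rw [hind _ (by omega), hind _ (by omega)]
    simp only [hind']
    -- Here `v` is 0/1-valued up to `m`, so at most one increment is nonzero, and it equals one.
    by_cases hj : ∃ l : Fin m, v l = 0 ∧ v (l + 1) = 1
    · obtain ⟨l, hl0, hl1⟩ := hj
      have hoth : ∀ i : Fin m, i ≠ l → v (i + 1) = v i := by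
        intro i hi
        rcases lt_or_gt_of_ne hi with hlt | hlt
        · have hlt' : (i : ℕ) < l := hlt
          have h1 := hv (show (i : ℕ) + 1 ≤ l by omega)
          have h2 := hv (show (i : ℕ) ≤ l by omega)
          omega
        · have hlt' : (l : ℕ) < i := hlt
          have h1 := hv (show (l : ℕ) + 1 ≤ i by omega)
          have h2 := hv (show (i : ℕ) ≤ i + 1 by omega)
          have h3 := hle (i + 1) (by omega)
          omega
      rw [Finset.sum_eq_single l (fun i _ hi => by simp [hoth i hi]) (by simp),
        Finset.sum_eq_single l (fun i _ hi => by simp [hoth i hi]) (by simp), hl0, hl1]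
      simp
    · push Not at hj
      have hoth : ∀ i : Fin m, v (i + 1) = v i := by
        intro i
        have h1 := hj i
        have h2 := hv (show (i : ℕ) ≤ i + 1 by omega)
        have h3 := hle (i + 1) (by omega)
        omega
      rw [Finset.sum_eq_zero (fun i _ => by simp [hoth i]),
        Finset.sum_eq_zero (fun i _ => by simp [hoth i])]
      simp

/-- Taking expectations in `norm_exp_increments_sub_le` costs a multiple of `P(V m ≥ 2)`; replacing
the true probabilities by the approximate `q l` costs the remaining sum, with the factor 2 bounding
`‖exp(iθ) - 1‖`. -/
lemma norm_integral_exp_increments_sub_le {Ω : Type*} [MeasurableSpace Ω] (P : Measure Ω)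
    [IsProbabilityMeasure P] {m : ℕ} (θ : Fin m → ℝ) (V : ℕ → Ω → ℕ) (hV : ∀ l, Measurable (V l))
    (hmono : ∀ᵐ ω ∂P, Monotone fun l => V l ω) (q ε : ℕ → ℝ)
    (h1 : ∀ l, |P.real {ω | 1 ≤ V l ω} - q l| ≤ ε l) (h2 : P.real {ω | 2 ≤ V m ω} ≤ ε m) :
    ‖∫ ω, incrExp θ (fun l => V l ω) ∂P - (1 + ∑ l : Fin m, (Complex.exp (θ l * Complex.I) - 1) *
          ((q (l + 1) - q l : ℝ) : ℂ))‖ ≤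
      (2 + 2 * m) * ε m + ∑ l : Fin m, 2 * (ε (l + 1) + ε l) := by
  set z : Fin m → ℂ := fun l => Complex.exp (θ l * Complex.I) - 1 with hz
  have hz2 : ∀ l, ‖z l‖ ≤ 2 := fun l => by
    refine (norm_sub_le _ _).trans ?_
    rw [Complex.norm_exp_ofReal_mul_I, norm_one]; norm_num
  set p : ℕ → ℝ := fun l => P.real {ω | 1 ≤ V l ω} with hp
  have hmeas : ∀ (a l : ℕ), MeasurableSet {ω | a ≤ V l ω} := fun a l =>
    measurableSet_le measurable_const (hV l)
  have hmeas' : ∀ (a l : ℕ), Measurable fun ω =>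
      Set.indicator {b : ℕ | a ≤ b} (1 : ℕ → ℝ) (V l ω) := fun a l =>
    (measurable_of_countable (Set.indicator {b : ℕ | a ≤ b} (1 : ℕ → ℝ))).comp (hV l)
  have hint : ∀ (a l : ℕ), Integrable (fun ω =>
      Set.indicator {b : ℕ | a ≤ b} (1 : ℕ → ℝ) (V l ω)) P := by
    intro a l
    refine Integrable.of_bound (hmeas' a l).aestronglyMeasurable 1 (ae_of_all _ fun ω => ?_)
    simp only [Set.indicator_apply, Pi.one_apply]
    split_ifs <;> norm_num
  have hintv : ∀ (a l : ℕ), ∫ ω, Set.indicator {b : ℕ | a ≤ b} (1 : ℕ → ℝ) (V l ω) ∂P =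
      P.real {ω | a ≤ V l ω} := by
    intro a l
    rw [← integral_indicator_one (hmeas a l)]
    rfl
  set F : Ω → ℂ := fun ω => incrExp θ (fun l => V l ω) with hF
  set G : Ω → ℂ := fun ω => 1 + ∑ l : Fin m, z l *
    ((Set.indicator {a : ℕ | 1 ≤ a} 1 (V (l + 1) ω) -
      Set.indicator {a : ℕ | 1 ≤ a} 1 (V l ω) : ℝ) : ℂ) with hG
  have hFint : Integrable F P := by
    have hm : Measurable F := (measurable_incrExp θ).comp (measurable_pi_lambda _ hV)
    exact Integrable.of_bound hm.aestronglyMeasurable 1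
      (ae_of_all _ fun ω => (norm_incrExp _ _).le)
  have hGint0 : ∀ l : Fin m, Integrable (fun ω => z l *
      ((Set.indicator {a : ℕ | 1 ≤ a} 1 (V (l + 1) ω) -
        Set.indicator {a : ℕ | 1 ≤ a} 1 (V l ω) : ℝ) : ℂ)) P := fun l =>
    (((hint 1 (l + 1)).sub (hint 1 l)).ofReal).const_mul _
  have hGint : Integrable G P :=
    (integrable_const 1).add (integrable_finsetSum _ fun l _ => hGint0 l)
  have hGv : ∫ ω, G ω ∂P = 1 + ∑ l : Fin m, z l * ((p (l + 1) - p l : ℝ) : ℂ) := by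
    rw [hG, integral_add (integrable_const 1) (integrable_finsetSum _ fun l _ => hGint0 l),
      integral_finsetSum _ fun l _ => hGint0 l]
    simp only [integral_const, probReal_univ, one_smul]
    congr 1
    refine Finset.sum_congr rfl fun l _ => ?_
    have ho := integral_ofReal (𝕜 := ℂ) (μ := P) (f := fun ω =>
      Set.indicator {a : ℕ | 1 ≤ a} (1 : ℕ → ℝ) (V (l + 1) ω) -
        Set.indicator {a : ℕ | 1 ≤ a} (1 : ℕ → ℝ) (V l ω))
    rw [integral_sub (hint 1 (l + 1)) (hint 1 l), hintv, hintv] at ho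
    rw [integral_const_mul]
    exact congrArg _ ho
  have hFG : ‖∫ ω, F ω ∂P - ∫ ω, G ω ∂P‖ ≤ (2 + 2 * m) * ε m := by
    rw [← integral_sub hFint hGint]
    refine (norm_integral_le_of_norm_le ((hint 2 m).const_mul (2 + 2 * (m : ℝ))) ?_).trans ?_
    · filter_upwards [hmono] with ω hω
      exact norm_exp_increments_sub_le θ (fun l => V l ω) hω
    · rw [integral_const_mul, hintv]
      gcongr
  have hGq : ‖∫ ω, G ω ∂P - (1 + ∑ l : Fin m, z l * ((q (l + 1) - q l : ℝ) : ℂ))‖ ≤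
      ∑ l : Fin m, 2 * (ε (l + 1) + ε l) := by
    rw [hGv, add_sub_add_left_eq_sub, ← Finset.sum_sub_distrib]
    refine norm_sum_le_of_le _ fun l _ => ?_
    rw [← mul_sub, norm_mul, ← Complex.ofReal_sub, Complex.norm_real]
    have h3 : ‖p (l + 1) - p l - (q (l + 1) - q l)‖ ≤ ε (l + 1) + ε l := by
      have a1 := abs_le.1 (h1 (l + 1))
      have a2 := abs_le.1 (h1 l)
      rw [Real.norm_eq_abs, abs_le]
      constructor <;> simp only [hp] <;> linarith
    exact mul_le_mul (hz2 l) h3 (norm_nonneg _) (by norm_num)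
  calc _ = ‖(∫ ω, F ω ∂P - ∫ ω, G ω ∂P) +
        (∫ ω, G ω ∂P - (1 + ∑ l : Fin m, z l * ((q (l + 1) - q l : ℝ) : ℂ)))‖ := by
        congr 1; ring
    _ ≤ _ := (norm_add_le _ _).trans (add_le_add hFG hGq)

/-- Poisson limit theorem for the increments of a sum of independent counting processes, each of
which is rarely nonzero and almost never exceeds one. -/
theorem tendsto_measure_increments {Ω : ℕ → Type*} [∀ n, MeasurableSpace (Ω n)]
    (P : ∀ n, Measure (Ω n)) [∀ n, IsProbabilityMeasure (P n)] {m : ℕ} (t : ℕ → ℝ≥0)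
    (ht : Monotone t) (V : ∀ n, Fin n → ℕ → Ω n → ℕ) (hV : ∀ n j l, Measurable (V n j l))
    (hmono : ∀ n j, ∀ᵐ ω ∂P n, Monotone fun l => V n j l ω)
    (hind : ∀ n, iIndepFun (fun j ω l => V n j l ω) (P n))
    (ε : ∀ n, Fin n → ℕ → ℝ) (hε : ∀ l, Tendsto (fun n => ∑ j, ε n j l) atTop (𝓝 0))
    (h1 : ∀ n j l, |(P n).real {ω | 1 ≤ V n j l ω} - t l / n| ≤ ε n j l)
    (h2 : ∀ n j l, (P n).real {ω | 2 ≤ V n j l ω} ≤ ε n j l) (A : Set (Fin m → ℤ)) :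
    Tendsto (fun n => P n {ω | (fun l : Fin m =>
        ((∑ j, V n j (l + 1) ω : ℕ) : ℤ) - (∑ j, V n j l ω : ℕ)) ∈ A}) atTop
      (𝓝 (Measure.pi (fun l : Fin m => poissonMeasure (t (l + 1) - t l))
        {x | (fun l => (x l : ℤ)) ∈ A})) := by
  have hD : ∀ n, Measurable fun ω => fun l : Fin m =>
      ((∑ j, V n j (l + 1) ω : ℕ) : ℤ) - (∑ j, V n j l ω : ℕ) := by
    intro n
    refine measurable_pi_lambda _ fun l => ?_
    have hs : ∀ l, Measurable fun ω => ∑ j, V n j l ω := fun l =>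
      Finset.measurable_sum _ fun j _ => hV n j l
    exact (measurable_of_countable (fun x : ℕ × ℕ => ((x.1 : ℤ) - x.2 : ℤ))).comp
      ((hs (l + 1)).prodMk (hs l))
  refine tendsto_measure_of_tendsto_charFun_int P _ _ hD (fun (x : Fin m → ℕ) l => (x l : ℤ))
    (by fun_prop) (fun θ => ?_) A
  rw [integral_exp_pi_poissonMeasure]
  set z : Fin m → ℂ := fun l => Complex.exp (θ l * Complex.I) - 1 with hz
  set w : ℂ := ∑ l : Fin m, ((t (l + 1) - t l : ℝ≥0) : ℝ) * z l with hw
  -- This keeps the comparison factors `exp (w / n)` in the unit disc, as `norm_prod_sub_prod_le`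
  -- requires.
  have hwre : w.re ≤ 0 := by
    rw [hw, Complex.re_sum]
    refine Finset.sum_nonpos fun l _ => ?_
    rw [Complex.re_ofReal_mul]
    refine mul_nonpos_of_nonneg_of_nonpos (NNReal.coe_nonneg _) ?_
    simp only [hz, Complex.sub_re, Complex.one_re, Complex.exp_ofReal_mul_I_re]
    linarith [Real.cos_le_one (θ l)]
  let c : ∀ n, Fin n → ℂ := fun n j => ∫ ω, incrExp θ (fun l => V n j l ω) ∂P n
  have hprod : ∀ n, ∫ ω, Complex.exp ((∑ l : Fin m, ((((∑ j, V n j (l + 1) ω : ℕ) : ℤ) -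
      (∑ j, V n j l ω : ℕ) : ℤ) : ℝ) * θ l : ℝ) * Complex.I) ∂P n = ∏ j, c n j := by
    intro n
    have hi := (hind n).integral_fun_prod_comp (f := fun _ => incrExp θ)
      (fun j => (measurable_pi_lambda _ fun l => hV n j l).aemeasurable)
      fun j => (measurable_incrExp θ).aestronglyMeasurable
    simp only [← incrExp_sum] at hi
    exact hi
  simp only [hprod]
  have hlim : Tendsto (fun n => ∏ j, c n j - Complex.exp w) atTop (𝓝 0) := by
    have hbound : Tendsto (fun n : ℕ => (2 + 2 * m) * (∑ j, ε n j m) + ∑ l : Fin m,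
        2 * ((∑ j, ε n j (l + 1)) + ∑ j, ε n j l) + ‖w‖ ^ 2 / n) atTop (𝓝 0) := by
      have h3 : Tendsto (fun n : ℕ => ‖w‖ ^ 2 / n) atTop (𝓝 0) :=
        tendsto_const_div_atTop_nhds_zero_nat _
      have h4 := tendsto_finsetSum (Finset.univ : Finset (Fin m))
        fun l _ => ((hε (l + 1)).add (hε l)).const_mul 2
      simpa using (((hε m).const_mul (2 + 2 * (m : ℝ))).add h4).add h3
    refine squeeze_zero_norm' ?_ hbound
    -- For such `n` one has `‖w / n‖ ≤ 1`, so `exp (w / n) = 1 + w / n` up to `‖w‖² / n²`; summed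
    -- over the `n` factors this error is `‖w‖² / n`.
    filter_upwards [eventually_ge_atTop (max 1 (Nat.ceil ‖w‖))] with n hn
    have hn1 : 1 ≤ n := (le_max_left _ _).trans hn
    have hn0 : (0 : ℝ) < n := by exact_mod_cast hn1
    have hwn : ‖w / n‖ ≤ 1 := by
      rw [norm_div, Complex.norm_natCast, div_le_one hn0]
      exact (Nat.le_ceil _).trans (by exact_mod_cast (le_max_right _ _).trans hn)
    have hexpw : Complex.exp w = ∏ _j : Fin n, Complex.exp (w / n) := by
      rw [Finset.prod_const, Finset.card_univ, Fintype.card_fin, ← Complex.exp_nat_mul,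
        mul_div_cancel₀ _ (by exact_mod_cast hn0.ne')]
    rw [hexpw]
    refine (norm_prod_sub_prod_le _ _ _ (fun j _ => ?_) (fun j _ => ?_)).trans ?_
    · refine (norm_integral_le_of_norm_le_const (C := 1) (ae_of_all _ fun ω => ?_)).trans (by simp)
      rw [norm_incrExp]
    · rw [Complex.norm_exp, Real.exp_le_one_iff, ← Complex.ofReal_natCast, Complex.div_ofReal_re]
      exact div_nonpos_of_nonpos_of_nonneg hwre hn0.le
    · have hj : ∀ j : Fin n, ‖c n j - Complex.exp (w / n)‖ ≤ (2 + 2 * m) * ε n j m +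
          ∑ l : Fin m, 2 * (ε n j (l + 1) + ε n j l) + ‖w‖ ^ 2 / n ^ 2 := by
        intro j
        have hc := norm_integral_exp_increments_sub_le (P n) θ (V n j) (hV n j) (hmono n j)
          (fun l => t l / n) (ε n j) (h1 n j) (h2 n j m)
        have he := Complex.norm_exp_sub_one_sub_id_le hwn
        rw [norm_div, Complex.norm_natCast, div_pow] at he
        have hsum : ∑ l : Fin m, (Complex.exp (θ l * Complex.I) - 1) *
            (((t (l + 1) : ℝ) / n - t l / n : ℝ) : ℂ) = w / n := by
          rw [hw, Finset.sum_div]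
          refine Finset.sum_congr rfl fun l _ => ?_
          rw [NNReal.coe_sub (ht (by omega))]
          simp only [hz]
          push_cast
          ring
        rw [hsum] at hc
        calc ‖c n j - Complex.exp (w / n)‖
            = ‖(c n j - (1 + w / n)) - (Complex.exp (w / n) - 1 - w / n)‖ := by congr 1; ring
          _ ≤ _ := (norm_sub_le _ _).trans (add_le_add hc he)
      refine (Finset.sum_le_sum fun j _ => hj j).trans (le_of_eq ?_)
      rw [Finset.sum_add_distrib, Finset.sum_add_distrib, ← Finset.mul_sum, Finset.sum_comm]
      congr 1
      · congr 1
        refine Finset.sum_congr rfl fun l _ => ?_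
        rw [← Finset.mul_sum, Finset.sum_add_distrib]
      · rw [Finset.sum_const, Finset.card_univ, Fintype.card_fin, nsmul_eq_mul]
        field_simp
  simpa using! hlim.add_const (Complex.exp w)

end PoissonLimit

/-! ### Hitting times of counting processes -/

section HittingTimes

/-- The hypotheses make `A` a ray containing its infimum. It serves both for jump times and for
points of a point process. -/
lemma csInf_le_iff_mem {α : Type*} [ConditionallyCompleteLinearOrder α] {A : Set α}
    (hb : BddBelow A) (hne : A.Nonempty) (hup : ∀ s ∈ A, ∀ t, s ≤ t → t ∈ A)
    (hright : ∀ t, (∀ s, t < s → s ∈ A) → t ∈ A) (c : α) : sInf A ≤ c ↔ c ∈ A := by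
  refine ⟨fun h => hright c fun s hs => ?_, fun h => csInf_le hb h⟩
  obtain ⟨a, ha, has⟩ := (csInf_lt_iff hb hne).1 (h.trans_lt hs)
  exact hup a ha s has.le

/-- Every finite set of times is covered by a finite nondecreasing sequence starting at zero. -/
lemma exists_monotone_seq_cover (G : Finset ℝ≥0) :
    ∃ (m : ℕ) (t : ℕ → ℝ≥0), Monotone t ∧ t 0 = 0 ∧ (∀ l, t l = 0 ∨ t l ∈ G) ∧
      ∀ g ∈ G, ∃ l ≤ m, t l = g := by
  induction G using Finset.induction_on_max with
  | empty => exact ⟨0, fun _ => 0, monotone_const, rfl, fun _ => Or.inl rfl, by simp⟩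
  | insert g G hg ih =>
    obtain ⟨m, t, hmono, h0, hmem, hcov⟩ := ih
    refine ⟨m + 1, fun l => if l ≤ m then t l else g, ?_, by simp [h0], ?_, ?_⟩
    · intro i j hij
      simp only
      split_ifs with hi hj hj
      · exact hmono hij
      · rcases hmem i with h | h
        · rw [h]; exact zero_le
        · exact (hg _ h).le
      · omega
      · exact le_rfl
    · intro l
      simp only
      split_ifs
      · exact (hmem l).imp_right fun h => Finset.mem_insert_of_mem h
      · exact Or.inr (Finset.mem_insert_self _ _)
    · intro g' hg'
      rcases Finset.mem_insert.1 hg' with rfl | h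
      · exact ⟨m + 1, le_rfl, by simp⟩
      · obtain ⟨l, hl, rfl⟩ := hcov g' h
        exact ⟨l, by omega, by simp [hl]⟩

/-- Grid values are recovered from increments because the path starts at zero; this lets
hitting-time events be read off the increment vector. -/
lemma eq_sum_increments {m : ℕ} (f : ℕ → ℕ) (h0 : f 0 = 0) (l : ℕ) (hl : l ≤ m) :
    (f l : ℤ) = ∑ r : Fin m, if (r : ℕ) < l then ((f (r + 1) : ℤ) - f r) else 0 := by
  rw [Fin.sum_univ_eq_sum_range (fun r => if r < l then ((f (r + 1) : ℤ) - f r) else 0),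
    ← Finset.sum_filter]
  have : (Finset.range m).filter (fun r => r < l) = Finset.range l := by
    ext r
    simp only [Finset.mem_filter, Finset.mem_range]
    omega
  rw [this, Finset.sum_range_sub (fun r => (f r : ℤ)), h0]
  simp

/-- Convergence of the laws of the increments of counting processes implies joint convergence in
distribution of their hitting times. -/
theorem tendstoInDistribution_of_increments {Ω : ℕ → Type*} [∀ n, MeasurableSpace (Ω n)]
    (P : ∀ n, Measure (Ω n)) [∀ n, IsProbabilityMeasure (P n)] {Ω' : Type*} [MeasurableSpace Ω']
    (P' : Measure Ω') [IsProbabilityMeasure P'] {ι : Type*} [Fintype ι] (κ : ι → ℕ)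
    (τ : ∀ n, Ω n → ι → ℝ) (hτ : ∀ n, AEMeasurable (τ n) (P n))
    (τ' : Ω' → ι → ℝ) (hτ' : AEMeasurable τ' P')
    (X : ∀ n, ℝ≥0 → Ω n → ℕ) (Y : ℝ≥0 → Ω' → ℕ)
    (hX0 : ∀ n, ∀ᵐ ω ∂P n, X n 0 ω = 0) (hY0 : ∀ᵐ ω ∂P', Y 0 ω = 0)
    (hX : ∀ᶠ n in atTop, ∀ᵐ ω ∂P n, ∀ i c, τ n ω i ≤ c ↔ κ i ≤ X n c.toNNReal ω)
    (hY : ∀ᵐ ω ∂P', ∀ i c, τ' ω i ≤ c ↔ κ i ≤ Y c.toNNReal ω)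
    (hlim : ∀ (m : ℕ) (t : ℕ → ℝ≥0), Monotone t → t 0 = 0 → ∀ A : Set (Fin m → ℤ),
      Tendsto (fun n => P n {ω | (fun l : Fin m => (X n (t (l + 1)) ω : ℤ) - X n (t l) ω) ∈ A})
        atTop (𝓝 (P' {ω | (fun l : Fin m => (Y (t (l + 1)) ω : ℤ) - Y (t l) ω) ∈ A}))) :
    TendstoInDistribution τ atTop τ' P P' where
  forall_aemeasurable := hτ
  aemeasurable_limit := hτ'
  tendsto := by
    -- Half-open boxes form a π-system with arbitrarily small neighbourhoods of each point, so
    -- convergence of all box probabilities gives weak convergence.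
    let S : Set (Set (ι → ℝ)) :=
      {s | ∃ a b : ι → ℝ, s = Set.univ.pi fun i => Set.Ioc (a i) (b i)}
    have hSmeas : ∀ s ∈ S, MeasurableSet s := by
      rintro s ⟨a, b, rfl⟩
      exact MeasurableSet.univ_pi fun i => measurableSet_Ioc
    have hSpi : IsPiSystem S := by
      rintro s ⟨a, b, rfl⟩ s' ⟨a', b', rfl⟩ -
      refine ⟨a ⊔ a', b ⊓ b', ?_⟩
      rw [← Set.pi_inter_distrib]
      simp only [Set.Ioc_inter_Ioc, Pi.sup_apply, Pi.inf_apply]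
    have hSnhds : ∀ u : Set (ι → ℝ), IsOpen u → ∀ x ∈ u, ∃ s ∈ S, s ∈ 𝓝 x ∧ s ⊆ u := by
      intro u hu x hx
      obtain ⟨ε, hε, hball⟩ := Metric.isOpen_iff.1 hu x hx
      refine ⟨Set.univ.pi fun i => Set.Ioc (x i - ε / 2) (x i + ε / 2), ⟨_, _, rfl⟩, ?_, ?_⟩
      · exact set_pi_mem_nhds Set.finite_univ fun i _ =>
          Ioc_mem_nhds (by linarith) (by linarith)
      · intro y hy
        refine hball ?_
        rw [Metric.mem_ball, dist_pi_lt_iff hε]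
        intro i
        have := hy i trivial
        rw [Real.dist_eq, abs_lt]
        constructor <;> linarith [this.1, this.2]
    refine hSpi.tendsto_probabilityMeasure_of_tendsto_of_mem hSmeas hSnhds ?_
    rintro s ⟨a, b, rfl⟩
    classical
    obtain ⟨m, t, ht, ht0, -, hcov⟩ := exists_monotone_seq_cover
      (Finset.univ.image (fun i => (a i).toNNReal) ∪ Finset.univ.image (fun i => (b i).toNNReal))
    have ha : ∀ i, ∃ l ≤ m, t l = (a i).toNNReal := fun i => hcov _ (by simp)
    have hb : ∀ i, ∃ l ≤ m, t l = (b i).toNNReal := fun i => hcov _ (by simp)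
    choose la hla hla' using ha
    choose lb hlb hlb' using hb
    -- The two sums stand for the counts at times `a i` and `b i`, so membership encodes `a i < τ i
    -- ≤ b i`. Negative endpoints are clamped to time 0.
    let A : Set (Fin m → ℤ) := {d | ∀ i,
      ¬ ((κ i : ℤ) ≤ ∑ r : Fin m, if (r : ℕ) < la i then d r else 0) ∧
        ((κ i : ℤ) ≤ ∑ r : Fin m, if (r : ℕ) < lb i then d r else 0)}
    have hA : ∀ f : ℝ≥0 → ℕ, f 0 = 0 → ∀ τ₀ : ι → ℝ, (∀ i c, τ₀ i ≤ c ↔ κ i ≤ f c.toNNReal) →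
        (τ₀ ∈ Set.univ.pi (fun i => Set.Ioc (a i) (b i)) ↔
          (fun l : Fin m => (f (t (l + 1)) : ℤ) - f (t l)) ∈ A) := by
      intro f hf0 τ₀ hτ₀
      simp only [A, Set.mem_pi, Set.mem_univ, true_implies, Set.mem_Ioc, Set.mem_ofPred_eq]
      refine forall_congr' fun i => ?_
      have h0 : f (t 0) = 0 := by rw [ht0, hf0]
      rw [← eq_sum_increments (fun l => f (t l)) h0 _ (hla i),
        ← eq_sum_increments (fun l => f (t l)) h0 _ (hlb i), hla' i, hlb' i, Nat.cast_le,
        Nat.cast_le, ← hτ₀, ← hτ₀, not_le]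
    have hboxmeas : MeasurableSet (Set.univ.pi fun i => Set.Ioc (a i) (b i)) :=
      MeasurableSet.univ_pi fun i => measurableSet_Ioc
    have key := hlim m t ht ht0 A
    have e1 : P' {ω | (fun l : Fin m => (Y (t (l + 1)) ω : ℤ) - Y (t l) ω) ∈ A} =
        P'.map τ' (Set.univ.pi fun i => Set.Ioc (a i) (b i)) := by
      rw [Measure.map_apply_of_aemeasurable hτ' hboxmeas]
      refine measure_congr ?_
      filter_upwards [hY0, hY] with ω h0 h
      exact propext (hA (fun s => Y s ω) h0 (τ' ω) h).symm
    have e2 : ∀ᶠ n in atTop,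
        P n {ω | (fun l : Fin m => (X n (t (l + 1)) ω : ℤ) - X n (t l) ω) ∈ A} =
        (P n).map (τ n) (Set.univ.pi fun i => Set.Ioc (a i) (b i)) := by
      filter_upwards [hX] with n hn
      rw [Measure.map_apply_of_aemeasurable (hτ n) hboxmeas]
      refine measure_congr ?_
      filter_upwards [hX0 n, hn] with ω h0 h
      exact propext (hA (fun s => X n s ω) h0 (τ n ω) h).symm
    rw [e1] at key
    have key' := key.congr' e2
    have : IsProbabilityMeasure (P'.map τ') := Measure.isProbabilityMeasure_map hτ'
    have hnt : P'.map τ' (Set.univ.pi fun i => Set.Ioc (a i) (b i)) ≠ ∞ := measure_ne_top _ _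
    exact (ENNReal.tendsto_toNNReal hnt).comp key'

/-- One-dimensional criterion for convergence in distribution via distribution functions that
converge everywhere. -/
theorem tendstoInDistribution_of_tendsto_Iic {Ω : ℕ → Type*} [∀ n, MeasurableSpace (Ω n)]
    (P : ∀ n, Measure (Ω n)) [∀ n, IsProbabilityMeasure (P n)]
    (ν : Measure ℝ) [IsProbabilityMeasure ν]
    (τ : ∀ n, Ω n → ℝ) (hτ : ∀ n, AEMeasurable (τ n) (P n))
    (hlim : ∀ c, Tendsto (fun n => P n {ω | τ n ω ≤ c}) atTop (𝓝 (ν (Set.Iic c)))) :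
    TendstoInDistribution τ atTop (id : ℝ → ℝ) P ν where
  forall_aemeasurable := hτ
  aemeasurable_limit := aemeasurable_id
  tendsto := by
    have : ∀ n, IsProbabilityMeasure ((P n).map (τ n)) := fun n =>
      Measure.isProbabilityMeasure_map (hτ n)
    let S : Set (Set ℝ) := {s | ∃ a b : ℝ, s = Set.Ioc a b}
    have hSpi : IsPiSystem S := by
      rintro s ⟨a, b, rfl⟩ s' ⟨a', b', rfl⟩ -
      exact ⟨a ⊔ a', b ⊓ b', Set.Ioc_inter_Ioc⟩
    refine hSpi.tendsto_probabilityMeasure_of_tendsto_of_mem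
      (by rintro s ⟨a, b, rfl⟩; exact measurableSet_Ioc) ?_ ?_
    · intro u hu x hx
      obtain ⟨ε, hε, hball⟩ := Metric.isOpen_iff.1 hu x hx
      refine ⟨Set.Ioc (x - ε / 2) (x + ε / 2), ⟨_, _, rfl⟩, Ioc_mem_nhds (by linarith)
        (by linarith), fun y hy => hball ?_⟩
      rw [Metric.mem_ball, Real.dist_eq, abs_lt]
      constructor <;> linarith [hy.1, hy.2]
    · rintro s ⟨a, b, rfl⟩
      rcases le_or_gt b a with hba | hab
      · simp [Set.Ioc_eq_empty_of_le hba]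
      have hIoc : ∀ (μ : Measure ℝ) [IsProbabilityMeasure μ],
          μ (Set.Ioc a b) = μ (Set.Iic b) - μ (Set.Iic a) := by
        intro μ _
        have hd : Set.Iic b \ Set.Iic a = Set.Ioc a b := by ext; simp [and_comm]
        rw [← hd, measure_sdiff (Set.Iic_subset_Iic.2 hab.le)
          measurableSet_Iic.nullMeasurableSet (measure_ne_top _ _)]
      have hIic : ∀ n c, (P n).map (τ n) (Set.Iic c) = P n {ω | τ n ω ≤ c} := fun n c =>
        Measure.map_apply_of_aemeasurable (hτ n) measurableSet_Iic
      have key := ENNReal.Tendsto.sub (hlim b) (hlim a) (Or.inl (measure_ne_top _ _))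
      rw [← hIoc ν] at key
      have key' : Tendsto (fun n => (P n).map (τ n) (Set.Ioc a b)) atTop
          (𝓝 (ν.map id (Set.Ioc a b))) := by
        rw [Measure.map_id]
        refine key.congr fun n => ?_
        rw [hIoc, hIic, hIic]
      have hnt : ν.map id (Set.Ioc a b) ≠ ∞ := by
        rw [Measure.map_id]
        exact measure_ne_top _ _
      exact (ENNReal.tendsto_toNNReal hnt).comp key'

/-- Path properties hold only almost surely, so sublevel sets are measurable only up to null sets;
the usual criterion is applied in the completed σ-algebra. -/
lemma aemeasurable_of_nullMeasurableSet_le {Ω : Type*} [MeasurableSpace Ω] {P : Measure Ω}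
    {f : Ω → ℝ} (h : ∀ c, NullMeasurableSet {ω | f ω ≤ c} P) : AEMeasurable f P := by
  have h' : NullMeasurable f P := fun s hs =>
    @measurable_of_Iic ℝ (NullMeasurableSpace Ω P) _ _ _ _ _ _ _ f h s hs
  exact h'.aemeasurable

end HittingTimes

/-! ### Poisson tails and the Gamma distribution -/

section PoissonGamma

/-- The product rule telescopes, leaving only the top term, which is the Gamma(`K + 1`, 1) density.
-/
lemma hasDerivAt_poisson_partial_sum (K : ℕ) (x : ℝ) :
    HasDerivAt (fun x : ℝ => -∑ i ∈ Finset.range (K + 1), Real.exp (-x) * x ^ i / i.factorial)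
      (Real.exp (-x) * x ^ K / K.factorial) x := by
  have hexp : HasDerivAt (fun x : ℝ => Real.exp (-x)) (-Real.exp (-x)) x := by
    simpa using (hasDerivAt_neg x).exp
  induction K with
  | zero => simpa using! hexp.neg
  | succ K ih =>
    have h := ih.sub ((hexp.mul (hasDerivAt_pow (K + 1) x)).div_const ((K + 1).factorial : ℝ))
    refine (h.congr_of_eventuallyEq (Eventually.of_forall fun y => ?_)).congr_deriv ?_
    · simp only [Pi.sub_apply, Pi.mul_apply]
      rw [Finset.sum_range_succ _ (K + 1)]
      ring
    · rw [Nat.factorial_succ]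
      have h1 : (K.factorial : ℝ) ≠ 0 := by positivity
      have h2 : ((K : ℝ) + 1) ≠ 0 := by positivity
      push_cast
      field_simp
      ring

/-- Both sides are the integral of the Gamma density over `[0, c]`, the Poisson tail being an
antiderivative of it. For `c < 0` both vanish. -/
lemma poissonMeasure_Ici_eq_gammaMeasure (k : ℕ) (hk : 0 < k) (c : ℝ) :
    poissonMeasure c.toNNReal {a | k ≤ a} = gammaMeasure k 1 (Set.Iic c) := by
  have hprob : IsProbabilityMeasure (gammaMeasure (k : ℝ) 1) :=
    isProbabilityMeasure_gammaMeasure (Nat.cast_pos.2 hk) one_pos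
  obtain ⟨K, rfl⟩ := Nat.exists_eq_succ_of_ne_zero hk.ne'
  rw [Nat.succ_eq_add_one] at *
  have hpois : (poissonMeasure c.toNNReal).real {a | K + 1 ≤ a} =
      1 - ∑ i ∈ Finset.range (K + 1),
        Real.exp (-(c.toNNReal : ℝ)) * (c.toNNReal : ℝ) ^ i / i.factorial := by
    have hc : {a | K + 1 ≤ a} = ((Finset.range (K + 1) : Finset ℕ) : Set ℕ)ᶜ := by
      ext a
      simp
    rw [hc, probReal_compl_eq_one_sub .of_discrete, ← sum_measureReal_singleton]
    simp only [poissonMeasure_real_singleton]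
  have hgam : (gammaMeasure ((K + 1 : ℕ) : ℝ) 1).real (Set.Iic c) =
      ∫ x in (0 : ℝ)..(c.toNNReal : ℝ), Real.exp (-x) * x ^ K / K.factorial := by
    rw [← cdf_eq_real, cdf_gammaMeasure_eq_integral (Nat.cast_pos.2 hk) one_pos]
    have hpdf : gammaPDFReal ((K + 1 : ℕ) : ℝ) 1 =
        Set.indicator (Set.Ici 0) fun x => Real.exp (-x) * x ^ K / K.factorial := by
      ext x
      rw [gammaPDFReal, Set.indicator_apply]
      simp only [Set.mem_Ici]
      split_ifs with hx
      · rw [Nat.cast_add, Nat.cast_one, Real.Gamma_nat_eq_factorial, Real.one_rpow,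
          add_sub_cancel_right, Real.rpow_natCast, one_mul]
        ring
      · rfl
    rw [hpdf, setIntegral_indicator measurableSet_Ici, intervalIntegral.integral_of_le
      (NNReal.coe_nonneg _), ← integral_Icc_eq_integral_Ioc]
    rcases le_or_gt 0 c with hc | hc
    · rw [Real.coe_toNNReal c hc, Set.inter_comm, Set.Ici_inter_Iic]
    · have : Set.Iic c ∩ Set.Ici 0 = ∅ := by
        ext x
        simp only [Set.mem_inter_iff, Set.mem_Iic, Set.mem_Ici, Set.mem_empty_iff_false,
          iff_false, not_and, not_le]
        exact fun h => h.trans_lt hc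
      rw [this, Real.toNNReal_of_nonpos hc.le]
      simp
  have hFTC := intervalIntegral.integral_eq_sub_of_hasDerivAt (a := 0) (b := (c.toNNReal : ℝ))
    (fun x _ => hasDerivAt_poisson_partial_sum K x)
    (Continuous.intervalIntegrable (by fun_prop) _ _)
  have h0 : ∑ i ∈ Finset.range (K + 1), Real.exp (-(0 : ℝ)) * (0 : ℝ) ^ i / i.factorial = 1 := by
    rw [Finset.sum_range_succ', Finset.sum_eq_zero (fun i _ => by simp)]
    simp
  rw [h0] at hFTC
  rw [← ENNReal.toReal_eq_toReal_iff' (measure_ne_top _ _) (measure_ne_top _ _)]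
  change (poissonMeasure c.toNNReal).real _ = (gammaMeasure ((K + 1 : ℕ) : ℝ) 1).real _
  rw [hpois, hgam, hFTC]
  ring

lemma tendsto_poissonMeasure_lt (i : ℕ) :
    Tendsto (fun m : ℕ => poissonMeasure (m : ℝ≥0) {a | a < i}) atTop (𝓝 0) := by
  have h : ∀ m : ℕ, poissonMeasure (m : ℝ≥0) {a | a < i} = ENNReal.ofReal (∑ l ∈ Finset.range i,
      Real.exp (-(m : ℝ)) * (m : ℝ) ^ l / l.factorial) := by
    intro m
    have hc : {a | a < i} = ((Finset.range i : Finset ℕ) : Set ℕ) := by ext a; simp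
    rw [hc, ← ENNReal.ofReal_toReal (measure_ne_top _ _)]
    congr 1
    change (poissonMeasure (m : ℝ≥0)).real _ = _
    rw [← sum_measureReal_singleton]
    simp [poissonMeasure_real_singleton]
  simp only [h]
  rw [← ENNReal.ofReal_zero]
  refine ENNReal.tendsto_ofReal ?_
  rw [show (0 : ℝ) = ∑ l ∈ Finset.range i, 0 by simp]
  refine tendsto_finsetSum _ fun l _ => ?_
  have h1 := ((Real.tendsto_pow_mul_exp_neg_atTop_nhds_zero l).comp
    tendsto_natCast_atTop_atTop).div_const (l.factorial : ℝ)
  rw [zero_div] at h1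
  refine h1.congr fun m => ?_
  simp only [Function.comp_apply]
  ring

end PoissonGamma

/-! ### Jumping times of Mallows processes -/

section JumpTimes

lemma sInf_le_inv_iff {Ω : Type*} {n : ℕ} {M : ℝ≥0 → Ω → Equiv.Perm (Fin n)} {k : ℕ} {ω : Ω}
    (hc : IsCadlag fun t => M t ω)
    (hm : ∀ s t, s < t → inv (M s ω) ≤ inv (M t ω)) (hne : ∃ t, k ≤ inv (M t ω)) (c : ℝ≥0) :
    sInf {t : ℝ≥0 | k ≤ inv (M t ω)} ≤ c ↔ k ≤ inv (M c ω) := by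
  refine csInf_le_iff_mem (OrderBot.bddBelow _) hne ?_ ?_ c
  · intro s hs t hst
    rcases hst.eq_or_lt with rfl | h
    · exact hs
    · exact le_trans hs (hm s t h)
  · intro t ht
    have h := hc.1 t
    -- In a discrete space right-continuity means that the path is constant just after `t`, so the
    -- infimum is attained.
    rw [ContinuousWithinAt, nhds_discrete, tendsto_pure] at h
    obtain ⟨s, hs, hts⟩ := (h.and self_mem_nhdsWithin).exists
    have hks : k ≤ inv (M s ω) := ht s hts
    change k ≤ inv (M t ω)
    rwa [← show M s ω = M t ω from hs]

lemma natCast_mul_jumpTime_le_iff {Ω : Type*} {n : ℕ} {M : ℝ≥0 → Ω → Equiv.Perm (Fin n)} {k : ℕ}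
    (hk : 0 < k) (hn : 0 < n) {ω : Ω}
    (hc : IsCadlag fun t => M t ω) (hm : ∀ s t, s < t → inv (M s ω) ≤ inv (M t ω))
    (hne : ∃ t, k ≤ inv (M t ω)) (h0 : inv (M 0 ω) = 0) (c : ℝ) :
    (n : ℝ) * jumpTime M k ω ≤ c ↔ k ≤ inv (M (c.toNNReal / n) ω) := by
  have hn' : (0 : ℝ) < n := by exact_mod_cast hn
  -- For negative `c` both sides fail: times are nonnegative, and the clamped time 0 carries no
  -- inversions while `0 < k`.
  rcases lt_or_ge c 0 with h | h
  · rw [Real.toNNReal_of_nonpos h.le, zero_div, h0]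
    constructor
    · intro h'
      have : 0 ≤ (n : ℝ) * jumpTime M k ω := mul_nonneg hn'.le (NNReal.coe_nonneg _)
      linarith
    · omega
  · rw [← sInf_le_inv_iff hc hm hne, jumpTime, ← NNReal.coe_le_coe, NNReal.coe_div,
      Real.coe_toNNReal c h, NNReal.coe_natCast, le_div_iff₀' hn']

variable {Ω : Type*} [MeasurableSpace Ω] {n : ℕ} {M : ℝ≥0 → Ω → Equiv.Perm (Fin n)}
  {P : Measure Ω}

lemma IsMallowsProcess.measure_mem (hM : IsMallowsProcess M P) (t : ℝ≥0)
    (A : Set (Equiv.Perm (Fin n))) : P {ω | M t ω ∈ A} = mallowsMeasure n t A := by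
  rw [← hM.law t, Measure.map_apply (hM.measurable t) .of_discrete]
  rfl

lemma IsMallowsProcess.measureReal_mem (hM : IsMallowsProcess M P) (t : ℝ≥0)
    (A : Set (Equiv.Perm (Fin n))) : P.real {ω | M t ω ∈ A} = (mallowsMeasure n t).real A := by
  rw [measureReal_def, hM.measure_mem, measureReal_def]

lemma IsMallowsProcess.ae_inv_zero (hM : IsMallowsProcess M P) [IsProbabilityMeasure P] :
    ∀ᵐ ω ∂P, inv (M 0 ω) = 0 := by
  have h : ∀ j : Fin n, ∀ᵐ ω ∂P, invAt j (M 0 ω) = 0 := by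
    intro j
    rw [ae_iff]
    have h1 := hM.measureReal_mem 0 {σ | 1 ≤ invAt j σ}
    have h2 := mallowsMeasure_le_invAt 0 j 1
    have h3 : P.real {ω | M 0 ω ∈ {σ | 1 ≤ invAt j σ}} = 0 :=
      le_antisymm (by rw [h1]; simpa using h2) measureReal_nonneg
    rw [measureReal_eq_zero_iff] at h3
    convert h3 using 2
    ext ω
    simp [Nat.one_le_iff_ne_zero]
  filter_upwards [ae_all_iff.2 h] with ω hω
  rw [inv_eq_sum_invAt]
  exact Finset.sum_eq_zero fun j _ => hω j

/-- If `inv` stays below `k < n`, then at every time some `invAt j` is below its maximum, which at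
time `i + 1` has probability at most `n / (i + 1)`. Hence the default value of the infimum occurs
only on a null set. -/
lemma IsMallowsProcess.ae_exists_le_inv (hM : IsMallowsProcess M P) [IsProbabilityMeasure P]
    {k : ℕ} (hk : k < n) : ∀ᵐ ω ∂P, ∃ t, k ≤ inv (M t ω) := by
  rw [ae_iff]
  set B := {ω | ¬ ∃ t, k ≤ inv (M t ω)} with hB
  have hsub : ∀ σ : Equiv.Perm (Fin n), inv σ < k → ∃ j : Fin n, invAt j σ < j := by
    intro σ hσ
    by_contra! h
    have h1 := h ⟨n - 1, by omega⟩
    have h2 : invAt ⟨n - 1, by omega⟩ σ ≤ inv σ := by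
      rw [inv_eq_sum_invAt]
      exact Finset.single_le_sum (f := fun j => invAt j σ) (fun _ _ => zero_le)
        (Finset.mem_univ _)
    simp only at h1
    omega
  have hle : ∀ i : ℕ, P.real B ≤ n * (1 / ((i : ℝ) + 1)) := by
    intro i
    calc P.real B ≤ P.real {ω | M ((i : ℝ≥0) + 1) ω ∈ ⋃ j : Fin n, {σ | invAt j σ < j}} := by
          refine measureReal_mono fun ω hω => ?_
          simp only [hB, Set.mem_ofPred_eq, not_exists, not_le] at hω
          simpa using hsub _ (hω ((i : ℝ≥0) + 1))
      _ = (mallowsMeasure n ((i : ℝ≥0) + 1)).real (⋃ j : Fin n, {σ | invAt j σ < j}) :=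
          hM.measureReal_mem _ _
      _ ≤ ∑ j : Fin n, (mallowsMeasure n ((i : ℝ≥0) + 1)).real {σ | invAt j σ < j} :=
          measureReal_iUnion_fintype_le _
      _ ≤ ∑ j : Fin n, 1 / (((i : ℝ≥0) + 1 : ℝ≥0) : ℝ) :=
          Finset.sum_le_sum fun j _ => mallowsMeasure_invAt_lt _ (by positivity) j
      _ = n * (1 / ((i : ℝ) + 1)) := by simp
  have hlim : Tendsto (fun i : ℕ => (n : ℝ) * (1 / ((i : ℝ) + 1))) atTop (𝓝 0) := by
    simpa using tendsto_one_div_add_atTop_nhds_zero_nat.const_mul (n : ℝ)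
  have h0 : P.real B = 0 :=
    le_antisymm (ge_of_tendsto' hlim hle) measureReal_nonneg
  exact (measureReal_eq_zero_iff).1 h0

lemma IsMonotone.aemeasurable_jumpTime (hM : IsMonotone M P) (k : ℕ) :
    AEMeasurable (jumpTime M k) P := by
  refine aemeasurable_of_nullMeasurableSet_le fun c => ?_
  rcases lt_or_ge c 0 with hc | hc
  · have : {ω | jumpTime M k ω ≤ c} = ∅ := by
      ext ω
      simp only [Set.mem_ofPred_eq, Set.mem_empty_iff_false, iff_false, not_le]
      exact hc.trans_le (NNReal.coe_nonneg _)
    rw [this]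
    exact MeasurableSet.empty.nullMeasurableSet
  · have hmeas : ∀ t : ℝ≥0, MeasurableSet {ω | k ≤ inv (M t ω)} := fun t =>
      hM.measurable t (.of_discrete (s := {σ | k ≤ inv σ}))
    -- The second set covers the paths that never reach level `k`, where the infimum of the empty
    -- set is 0, which is at most `c`. By monotonicity integer times suffice to detect them.
    have hset : MeasurableSet ({ω | k ≤ inv (M c.toNNReal ω)} ∪
        ⋂ i : ℕ, {ω | k ≤ inv (M (i : ℝ≥0) ω)}ᶜ) :=
      (hmeas _).union (MeasurableSet.iInter fun i => (hmeas _).compl)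
    refine hset.nullMeasurableSet.congr ?_
    filter_upwards [hM.cadlag, hM.inv_le] with ω h1 h2
    refine propext ?_
    change ω ∈ ({ω | k ≤ inv (M c.toNNReal ω)} ∪ ⋂ i : ℕ, {ω | k ≤ inv (M (i : ℝ≥0) ω)}ᶜ) ↔
      jumpTime M k ω ≤ c
    simp only [Set.mem_union, Set.mem_iInter, Set.mem_compl_iff, Set.mem_ofPred_eq]
    by_cases hne : ∃ t, k ≤ inv (M t ω)
    · have hnot : ¬ ∀ i : ℕ, ¬ k ≤ inv (M (i : ℝ≥0) ω) := by
        obtain ⟨t, ht⟩ := hne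
        obtain ⟨i, hi⟩ := exists_nat_gt t
        exact fun h => h i (ht.trans (h2 _ _ hi))
      rw [or_iff_left hnot, ← sInf_le_inv_iff h1 h2 hne, jumpTime,
        ← NNReal.coe_le_coe, Real.coe_toNNReal c hc]
    · have hempty : {t : ℝ≥0 | k ≤ inv (M t ω)} = ∅ := by
        ext t
        simpa using not_exists.1 hne t
      rw [jumpTime, hempty, NNReal.sInf_empty]
      simp only [NNReal.coe_zero, hc, iff_true]
      exact Or.inr fun i => not_exists.1 hne _

lemma IsMonotone.ae_natCast_mul_jumpTime_le_iff (hM : IsMonotone M P) [IsProbabilityMeasure P]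
    {k : ℕ} (hk : 0 < k) (hn : k < n) : ∀ᵐ ω ∂P, ∀ c : ℝ,
      (n : ℝ) * jumpTime M k ω ≤ c ↔ k ≤ inv (M (c.toNNReal / n) ω) := by
  filter_upwards [hM.cadlag, hM.inv_le, hM.ae_inv_zero,
    hM.ae_exists_le_inv hn] with ω h1 h2 h3 h4
  exact natCast_mul_jumpTime_le_iff hk (by omega) h1 h2 h4 h3

end JumpTimes

/-! ### Poisson limits for the inversion counts -/

section InversionLimits

/-- The error bound used for the `j`-th inversion count at parameter `q`. -/
noncomputable def invError (j : ℕ) (q : ℝ) : ℝ := (if j = 0 then q else 0) + q ^ 2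

/-- Only `j = 0` contributes a first-order term, since `invAt 0` is never positive; the sum is `x /
n + x² / n`. -/
lemma tendsto_sum_invError (x : ℝ≥0) :
    Tendsto (fun n : ℕ => ∑ j : Fin n, invError j ((x : ℝ) / n)) atTop (𝓝 0) := by
  have h1 : Tendsto (fun n : ℕ => (x : ℝ) / n + (x : ℝ) ^ 2 / n) atTop (𝓝 0) := by
    simpa using (tendsto_const_div_atTop_nhds_zero_nat (x : ℝ)).add
      (tendsto_const_div_atTop_nhds_zero_nat ((x : ℝ) ^ 2))
  refine h1.congr' ?_
  filter_upwards [eventually_gt_atTop 0] with n hn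
  have hn0 : (n : ℝ) ≠ 0 := by exact_mod_cast hn.ne'
  unfold invError
  rw [Finset.sum_add_distrib, Fin.sum_univ_eq_sum_range (fun j => if j = 0 then (x : ℝ) / n else 0),
    Finset.sum_ite_eq', if_pos (Finset.mem_range.2 hn), Finset.sum_const, Finset.card_univ,
    Fintype.card_fin, nsmul_eq_mul]
  field_simp

lemma abs_mallowsMeasure_invAt_sub_le {n : ℕ} (q : ℝ≥0) (j : Fin n) :
    |(mallowsMeasure n q).real {σ | 1 ≤ invAt j σ} - q| ≤ invError j q := by
  have h1 := mallowsMeasure_le_invAt q j 1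
  rw [pow_one] at h1
  have h2 : 0 ≤ (mallowsMeasure n q).real {σ | 1 ≤ invAt j σ} := measureReal_nonneg
  rw [abs_sub_comm, abs_of_nonneg (by linarith)]
  unfold invError
  split_ifs with hj
  · have := sq_nonneg (q : ℝ)
    linarith
  · linarith [mallowsMeasure_invAt_pos q j hj]

lemma mallowsMeasure_two_le_invAt {n : ℕ} (q : ℝ≥0) (j : Fin n) :
    (mallowsMeasure n q).real {σ | 2 ≤ invAt j σ} ≤ invError j q := by
  refine (mallowsMeasure_le_invAt q j 2).trans ?_
  unfold invError
  split_ifs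
  · linarith [q.2]
  · linarith

/-- Under the Mallows distribution with parameter `x / n`, the number of inversions is
asymptotically Poisson distributed with parameter `x`. -/
lemma tendsto_mallowsMeasure_le_inv (x : ℝ≥0) (k : ℕ) :
    Tendsto (fun n : ℕ => mallowsMeasure n (x / n) {σ | k ≤ inv σ}) atTop
      (𝓝 (poissonMeasure x {a | k ≤ a})) := by
  -- A one-step grid with an artificial zero start reduces the marginal statement to a single
  -- increment.
  let t : ℕ → ℝ≥0 := fun l => if l = 0 then 0 else x
  have ht : Monotone t := monotone_nat_of_le_succ fun l => by
    simp only [t]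
    split_ifs <;> simp_all
  let V : ∀ n : ℕ, Fin n → ℕ → Equiv.Perm (Fin n) → ℕ :=
    fun n j l σ => if l = 0 then 0 else invAt j σ
  have hind : ∀ n, iIndepFun (fun j σ l => V n j l σ) (mallowsMeasure n (x / n)) := fun n =>
    (iIndepFun_invAt n (x / n)).comp (fun _ a l => if l = 0 then 0 else a)
      fun _ => measurable_of_countable _
  have key := tendsto_measure_increments (m := 1) (fun n => mallowsMeasure n (x / n)) t ht V
    (fun n j l => .of_discrete)
    (fun n j => ae_of_all _ fun σ => monotone_nat_of_le_succ fun l => by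
      simp only [V]
      split_ifs <;> simp_all)
    hind (fun n j l => invError j ((t l : ℝ) / n)) (fun l => tendsto_sum_invError (t l)) ?_ ?_
    {d | (k : ℤ) ≤ d 0}
  · have e1 : ∀ n, {σ : Equiv.Perm (Fin n) | (fun l : Fin 1 => ((∑ j, V n j (l + 1) σ : ℕ) : ℤ) -
        (∑ j, V n j l σ : ℕ)) ∈ {d : Fin 1 → ℤ | (k : ℤ) ≤ d 0}} = {σ | k ≤ inv σ} := by
      intro n
      ext σ
      simp [V, inv_eq_sum_invAt]
      norm_cast
    have e2 : Measure.pi (fun l : Fin 1 => poissonMeasure (t (l + 1) - t l))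
        {y | (fun l => (y l : ℤ)) ∈ {d : Fin 1 → ℤ | (k : ℤ) ≤ d 0}} =
        poissonMeasure x {a | k ≤ a} := by
      have h := (measurePreserving_eval (fun l : Fin 1 => poissonMeasure (t (l + 1) - t l))
        0).measure_preimage (s := {a | k ≤ a}) MeasurableSet.of_discrete.nullMeasurableSet
      have hx : t (((0 : Fin 1) : ℕ) + 1) - t ((0 : Fin 1) : ℕ) = x := by simp [t]
      rw [hx] at h
      rw [← h]
      congr 1
      ext y
      simp
    simp only [e1, e2] at key
    exact key
  · intro n j l
    rcases Nat.eq_zero_or_pos l with rfl | hl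
    · simp [V, t, invError]
    · simpa [V, t, hl.ne'] using abs_mallowsMeasure_invAt_sub_le (x / n) j
  · intro n j l
    rcases Nat.eq_zero_or_pos l with rfl | hl
    · simp [V, t, invError]
    · simpa [V, t, hl.ne'] using mallowsMeasure_two_le_invAt (x / n) j

/-- The increments of the inversion numbers of regular Mallows processes at times of order `1 / n`
are asymptotically independent Poisson variables. -/
lemma tendsto_measure_inv_increments {Ω : ℕ → Type*} [∀ n, MeasurableSpace (Ω n)]
    (P : ∀ n, Measure (Ω n)) [∀ n, IsProbabilityMeasure (P n)]
    (M : ∀ n, ℝ≥0 → Ω n → Equiv.Perm (Fin n)) (hM : ∀ n, IsRegular (M n) (P n))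
    (m : ℕ) (t : ℕ → ℝ≥0) (ht : Monotone t) (A : Set (Fin m → ℤ)) :
    Tendsto (fun n => P n {ω | (fun l : Fin m => (inv (M n (t (l + 1) / n) ω) : ℤ) -
        inv (M n (t l / n) ω)) ∈ A}) atTop
      (𝓝 (Measure.pi (fun l : Fin m => poissonMeasure (t (l + 1) - t l))
        {x | (fun l => (x l : ℤ)) ∈ A})) := by
  let V : ∀ n : ℕ, Fin n → ℕ → Ω n → ℕ := fun n j l ω => invAt j (M n (t l / n) ω)
  have hmono : ∀ n j, ∀ᵐ ω ∂P n, Monotone fun l => V n j l ω := by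
    intro n j
    filter_upwards [(hM n).invAt_le] with ω hω
    intro l l' hll
    have h : t l / (n : ℝ≥0) ≤ t l' / n := by gcongr; exact ht hll
    rcases h.eq_or_lt with h | h
    · simp only [V, h, le_refl]
    · exact hω j _ _ h
  have hind : ∀ n, iIndepFun (fun j ω l => V n j l ω) (P n) := fun n =>
    (hM n).indep.comp (fun _ f l => f (t l / n))
      fun _ => measurable_pi_lambda _ fun l => measurable_pi_apply _
  have key := tendsto_measure_increments P t ht V
    (fun n j l => (measurable_of_countable (invAt j)).comp ((hM n).measurable _)) hmono hind
    (fun n j l => invError j ((t l : ℝ) / n)) (fun l => tendsto_sum_invError (t l)) ?_ ?_ A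
  · simpa only [V, ← inv_eq_sum_invAt] using key
  · intro n j l
    have h := (hM n).measureReal_mem (t l / n) {σ | 1 ≤ invAt j σ}
    simp only [Set.mem_ofPred_eq] at h
    simp only [V]
    rw [h]
    simpa using abs_mallowsMeasure_invAt_sub_le (t l / n) j
  · intro n j l
    have h := (hM n).measureReal_mem (t l / n) {σ | 2 ≤ invAt j σ}
    simp only [Set.mem_ofPred_eq] at h
    simp only [V]
    rw [h]
    simpa using mallowsMeasure_two_le_invAt (t l / n) j

end InversionLimits

/-! ### Poisson point processes -/

section PoissonPointProcess

variable {Ω : Type*} [MeasurableSpace Ω] {N : Ω → Set ℝ} {P : Measure Ω}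

/-- The Poisson masses at the natural numbers already add up to one, leaving none for `⊤`. -/
lemma IsPoissonPointProcess.ae_encard_ne_top [IsProbabilityMeasure P]
    (hN : IsPoissonPointProcess N 1 P) {B : Set ℝ} (hB : MeasurableSet B) (hB0 : B ⊆ Set.Ici 0)
    (hvol : volume B ≠ ∞) : ∀ᵐ ω ∂P, (N ω ∩ B).encard ≠ ⊤ := by
  have hmeas : ∀ m : ℕ, MeasurableSet {ω | (N ω ∩ B).encard = m} := fun m =>
    hN.measurable B hB (measurableSet_singleton (m : ℕ∞))
  have hset : {ω | (N ω ∩ B).encard ≠ ⊤} = ⋃ m : ℕ, {ω | (N ω ∩ B).encard = m} := by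
    ext ω
    simp only [Set.mem_ofPred_eq, Set.mem_iUnion]
    rw [ENat.ne_top_iff_exists]
    exact exists_congr fun m => eq_comm
  have hone : P {ω | (N ω ∩ B).encard ≠ ⊤} = 1 := by
    rw [hset, measure_iUnion _ hmeas]
    · simp only [hN.law B hB hB0 hvol]
      have := measure_iUnion (μ := poissonMeasure (1 * (volume B).toNNReal))
        (f := fun m : ℕ => ({m} : Set ℕ)) (fun a b hab => by simpa using hab)
        fun _ => .of_discrete
      rw [← this, Set.iUnion_of_singleton, measure_univ]
    · intro a b hab
      refine Set.disjoint_left.2 fun ω ha hb => hab ?_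
      have ha' : (N ω ∩ B).encard = a := ha
      have hb' : (N ω ∩ B).encard = b := hb
      exact_mod_cast ha'.symm.trans hb'
  rw [← prob_compl_eq_zero_iff₀] at hone
  · exact hone
  · rw [hset]
    exact (MeasurableSet.iUnion hmeas).nullMeasurableSet

lemma IsPoissonPointProcess.map_toNat_encard [IsProbabilityMeasure P]
    (hN : IsPoissonPointProcess N 1 P) {B : Set ℝ} (hB : MeasurableSet B) (hB0 : B ⊆ Set.Ici 0)
    (hvol : volume B ≠ ∞) :
    P.map (fun ω => (N ω ∩ B).encard.toNat) = poissonMeasure (volume B).toNNReal := by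
  have hmeas : Measurable fun ω => (N ω ∩ B).encard.toNat :=
    (measurable_of_countable ENat.toNat).comp (hN.measurable B hB)
  refine Measure.ext_of_singleton fun m => ?_
  rw [Measure.map_apply hmeas (measurableSet_singleton m), ← one_mul (volume B).toNNReal,
    ← hN.law B hB hB0 hvol m]
  refine measure_congr ?_
  filter_upwards [hN.ae_encard_ne_top hB hB0 hvol] with ω hω
  refine propext ?_
  change (N ω ∩ B).encard.toNat = m ↔ (N ω ∩ B).encard = m
  rw [← ENat.natCast_toNat hω]
  simp

/-- The number of points of a set of reals in `[0, t]`. -/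
noncomputable def count (S : Set ℝ) (t : ℝ≥0) : ℕ := (S ∩ Set.Icc 0 (t : ℝ)).encard.toNat

lemma IsPoissonPointProcess.ae_locallyFinite [IsProbabilityMeasure P]
    (hN : IsPoissonPointProcess N 1 P) : ∀ᵐ ω ∂P, ∀ t : ℝ, (N ω ∩ Set.Icc 0 t).Finite := by
  have h : ∀ᵐ ω ∂P, ∀ m : ℕ, (N ω ∩ Set.Icc 0 (m : ℝ)).encard ≠ ⊤ :=
    ae_all_iff.2 fun m => hN.ae_encard_ne_top measurableSet_Icc (fun x hx => hx.1) (by simp)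
  filter_upwards [h] with ω hω t
  obtain ⟨m, hm⟩ := exists_nat_ge t
  exact (Set.encard_ne_top_iff.1 (hω m)).subset
    (Set.inter_subset_inter_right _ (Set.Icc_subset_Icc_right hm))

lemma IsPoissonPointProcess.ae_count_zero [IsProbabilityMeasure P]
    (hN : IsPoissonPointProcess N 1 P) : ∀ᵐ ω ∂P, count (N ω) 0 = 0 := by
  have h := hN.law (Set.Icc 0 0) measurableSet_Icc (fun x hx => hx.1) (by simp) 0
  rw [Real.volume_Icc, poissonMeasure_singleton] at h
  simp only [sub_zero, ENNReal.ofReal_zero, ENNReal.toNNReal_zero, mul_zero, NNReal.coe_zero,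
    neg_zero, Real.exp_zero, pow_zero, Nat.factorial_zero, Nat.cast_one, div_one, one_mul,
    ENNReal.ofReal_one] at h
  have hm : MeasurableSet {ω | (N ω ∩ Set.Icc 0 0).encard = (0 : ℕ)} :=
    hN.measurable _ measurableSet_Icc (measurableSet_singleton _)
  rw [← prob_compl_eq_zero_iff hm] at h
  have h' : ∀ᵐ ω ∂P, (N ω ∩ Set.Icc 0 0).encard = (0 : ℕ) := h
  filter_upwards [h'] with ω hω
  rw [count, NNReal.coe_zero, hω]
  rfl

/-- The count on `[0, m]` is Poisson(`m`), and its probability of staying below `i` tends to zero.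
-/
lemma IsPoissonPointProcess.ae_exists_le_count [IsProbabilityMeasure P]
    (hN : IsPoissonPointProcess N 1 P) (i : ℕ) : ∀ᵐ ω ∂P, ∃ t : ℝ≥0, i ≤ count (N ω) t := by
  rw [ae_iff]
  refine le_antisymm (ge_of_tendsto' (tendsto_poissonMeasure_lt i) fun m => ?_) zero_le
  have hlaw := hN.map_toNat_encard (B := Set.Icc 0 (m : ℝ)) measurableSet_Icc
    (fun x hx => hx.1) (by simp)
  rw [Real.volume_Icc] at hlaw
  simp only [sub_zero, ENNReal.ofReal_natCast, ENNReal.toNNReal_natCast] at hlaw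
  have hmeas : Measurable fun ω => (N ω ∩ Set.Icc 0 (m : ℝ)).encard.toNat :=
    (measurable_of_countable ENat.toNat).comp (hN.measurable _ measurableSet_Icc)
  rw [← hlaw, Measure.map_apply hmeas .of_discrete]
  refine measure_mono fun ω hω => ?_
  simp only [Set.mem_ofPred_eq, not_exists, not_le] at hω
  simpa [count] using hω (m : ℝ≥0)

lemma nthPoint_le_iff {S : Set ℝ} (hfin : ∀ t : ℝ, (S ∩ Set.Icc 0 t).Finite)
    (h0 : count S 0 = 0) {i : ℕ} (hi : 0 < i) (hne : ∃ t : ℝ≥0, i ≤ count S t) (c : ℝ) :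
    nthPoint S i ≤ c ↔ i ≤ count S c.toNNReal := by
  have hcount : ∀ t : ℝ≥0, ((i : ℕ∞) ≤ (S ∩ Set.Icc 0 (t : ℝ)).encard ↔ i ≤ count S t) := by
    intro t
    rw [count, ← ENat.natCast_toNat (Set.encard_ne_top_iff.2 (hfin t))]
    simp
  have hkey : nthPoint S i ≤ c ↔ c ∈ {t : ℝ | 0 ≤ t ∧ (i : ℕ∞) ≤ (S ∩ Set.Icc 0 t).encard} := by
    refine csInf_le_iff_mem ⟨0, fun t ht => ht.1⟩ ?_ ?_ ?_ c
    · obtain ⟨t, ht⟩ := hne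
      exact ⟨t, t.2, (hcount t).2 ht⟩
    · intro s hs t hst
      exact ⟨hs.1.trans hst, hs.2.trans (Set.encard_le_encard
        (Set.inter_subset_inter_right _ (Set.Icc_subset_Icc_right hst)))⟩
    · intro t ht
      have ht0 : 0 ≤ t := le_of_forall_gt_imp_ge_of_dense fun s hs => (ht s hs).1
      refine ⟨ht0, ?_⟩
      -- By local finiteness some interval `(t, s]` contains no point, so the counting function is
      -- right-continuous at `t`.
      have hF : (S ∩ Set.Ioc t (t + 1)).Finite := (hfin (t + 1)).subset
        (Set.inter_subset_inter_right _ fun x hx => ⟨ht0.trans hx.1.le, hx.2⟩)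
      have hev : ∀ᶠ s in 𝓝[>] t, ∀ x ∈ S ∩ Set.Ioc t (t + 1), s < x := by
        rw [eventually_all_finite hF]
        intro x hx
        exact nhdsWithin_le_nhds (eventually_lt_nhds hx.2.1)
      have hev2 : ∀ᶠ s in 𝓝[>] t, s < t + 1 :=
        nhdsWithin_le_nhds (eventually_lt_nhds (lt_add_one t))
      obtain ⟨s, ⟨hs1, hs2⟩, hts⟩ := ((hev.and hev2).and self_mem_nhdsWithin).exists
      have hts' : t < s := hts
      refine (ht s hts').2.trans (Set.encard_le_encard fun x hx => ⟨hx.1, hx.2.1, ?_⟩)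
      by_contra! hlt
      have := hs1 x ⟨hx.1, hlt, by linarith [hx.2.2]⟩
      linarith [hx.2.2]
  rw [hkey]
  rcases lt_or_ge c 0 with hc | hc
  · rw [Real.toNNReal_of_nonpos hc.le, h0]
    simp only [Set.mem_ofPred_eq, not_le.2 hc, false_and, false_iff]
    omega
  · have h := hcount c.toNNReal
    rw [Real.coe_toNNReal c hc] at h
    simp only [Set.mem_ofPred_eq, hc, true_and, h]

lemma IsPoissonPointProcess.ae_nthPoint_le_iff [IsProbabilityMeasure P]
    (hN : IsPoissonPointProcess N 1 P) {i : ℕ} (hi : 0 < i) :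
    ∀ᵐ ω ∂P, ∀ c, nthPoint (N ω) i ≤ c ↔ i ≤ count (N ω) c.toNNReal := by
  filter_upwards [hN.ae_locallyFinite, hN.ae_count_zero, hN.ae_exists_le_count i] with ω h1 h2 h3
  exact nthPoint_le_iff h1 h2 hi h3

lemma IsPoissonPointProcess.aemeasurable_nthPoint [IsProbabilityMeasure P]
    (hN : IsPoissonPointProcess N 1 P) {i : ℕ} (hi : 0 < i) :
    AEMeasurable (fun ω => nthPoint (N ω) i) P := by
  refine aemeasurable_of_nullMeasurableSet_le fun c => ?_
  have hm : Measurable fun ω => count (N ω) c.toNNReal :=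
    (measurable_of_countable ENat.toNat).comp (hN.measurable _ measurableSet_Icc)
  have hset : MeasurableSet {ω | i ≤ count (N ω) c.toNNReal} :=
    measurableSet_le measurable_const hm
  refine hset.nullMeasurableSet.congr ?_
  filter_upwards [hN.ae_nthPoint_le_iff hi] with ω hω
  exact propext (hω c).symm

/-- The increments of the counting process of a Poisson point process are independent Poisson
variables. -/
lemma IsPoissonPointProcess.measure_count_increments [IsProbabilityMeasure P]
    (hN : IsPoissonPointProcess N 1 P) (m : ℕ) (t : ℕ → ℝ≥0) (ht : Monotone t)
    (A : Set (Fin m → ℤ)) :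
    P {ω | (fun l : Fin m => (count (N ω) (t (l + 1)) : ℤ) - count (N ω) (t l)) ∈ A} =
      Measure.pi (fun l : Fin m => poissonMeasure (t (l + 1) - t l))
        {x | (fun l => (x l : ℤ)) ∈ A} := by
  let B : Fin m → Set ℝ := fun l => Set.Ioc (t l : ℝ) (t (l + 1))
  have hBm : ∀ l, MeasurableSet (B l) := fun l => measurableSet_Ioc
  have hB0 : ∀ l, B l ⊆ Set.Ici 0 := fun l x hx => (NNReal.coe_nonneg (t l)).trans hx.1.le
  have hBv : ∀ l, volume (B l) ≠ ∞ := fun l => by simp [B]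
  -- Half-open intervals make consecutive blocks disjoint while their counts are exactly the
  -- increments of `count`.
  have hBdisj : Pairwise (Function.onFun Disjoint B) := by
    have haux : ∀ l l' : Fin m, l < l' → Disjoint (B l) (B l') := by
      intro l l' hll
      refine Set.disjoint_left.2 fun x hx hx' => ?_
      have h1 : t (l + 1) ≤ t l' := ht (by have : (l : ℕ) < l' := hll; omega)
      have h2 : ((t (l + 1) : ℝ≥0) : ℝ) ≤ t l' := by exact_mod_cast h1
      linarith [hx.2, hx'.1]
    intro l l' hll
    rcases lt_or_gt_of_ne hll with h | h
    · exact haux l l' h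
    · exact (haux l' l h).symm
  let D : Ω → Fin m → ℕ := fun ω l => (N ω ∩ B l).encard.toNat
  have hDm : ∀ l, Measurable fun ω => D ω l := fun l =>
    (measurable_of_countable ENat.toNat).comp (hN.measurable _ (hBm l))
  have hind : iIndepFun (fun l ω => D ω l) P :=
    (hN.indep m B hBm hBdisj).comp (fun _ => ENat.toNat) fun _ => measurable_of_countable _
  have hlaw : P.map D = Measure.pi fun l : Fin m => poissonMeasure (t (l + 1) - t l) := by
    have h := (iIndepFun_iff_map_fun_eq_pi_map fun l => (hDm l).aemeasurable).1 hind
    have hl : ∀ l, P.map (fun ω => D ω l) = poissonMeasure (t (l + 1) - t l) := by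
      intro l
      have := hN.map_toNat_encard (hBm l) (hB0 l) (hBv l)
      simp only [B, Real.volume_Ioc] at this
      rw [← NNReal.coe_sub (ht (by omega)), ENNReal.ofReal_coe_nnreal, ENNReal.toNNReal_coe] at this
      exact this
    simp only [hl] at h
    exact h
  have hDmeas : Measurable D := measurable_pi_lambda _ hDm
  rw [← hlaw, Measure.map_apply hDmeas .of_discrete]
  refine measure_congr ?_
  filter_upwards [hN.ae_locallyFinite] with ω hω
  have hcount : ∀ l : Fin m,
      (count (N ω) (t (l + 1)) : ℤ) - count (N ω) (t l) = (D ω l : ℤ) := by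
    intro l
    have htl : ((t l : ℝ≥0) : ℝ) ≤ t (l + 1) := by exact_mod_cast ht (by omega : (l : ℕ) ≤ l + 1)
    have hun : N ω ∩ Set.Icc 0 ((t (l + 1) : ℝ≥0) : ℝ) =
        (N ω ∩ Set.Icc 0 ((t l : ℝ≥0) : ℝ)) ∪ (N ω ∩ B l) := by
      rw [← Set.inter_union_distrib_left, Set.Icc_union_Ioc_eq_Icc (NNReal.coe_nonneg _) htl]
    have hdis : Disjoint (N ω ∩ Set.Icc 0 ((t l : ℝ≥0) : ℝ)) (N ω ∩ B l) :=
      Set.disjoint_left.2 fun x hx hx' => absurd hx.2.2 (not_le.2 hx'.2.1)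
    have hfin : (N ω ∩ B l).Finite := (hω (t (l + 1))).subset (by rw [hun]; simp)
    have h : count (N ω) (t (l + 1)) = count (N ω) (t l) + D ω l := by
      simp only [count, D]
      rw [hun, Set.encard_union_eq hdis, ENat.toNat_add
        (Set.encard_ne_top_iff.2 (hω _)) (Set.encard_ne_top_iff.2 hfin)]
    rw [h]
    push_cast
    ring
  refine propext ?_
  change (fun l : Fin m => (count (N ω) (t (l + 1)) : ℤ) - count (N ω) (t l)) ∈ A ↔
    (fun l => (D ω l : ℤ)) ∈ A
  simp only [hcount]

end PoissonPointProcess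

end Mallows

theorem theorem1p3 {Ω : ℕ → Type*} [∀ n, MeasurableSpace (Ω n)]
    (P : ∀ n, Measure (Ω n)) [∀ n, IsProbabilityMeasure (P n)]
    (M : ∀ n, ℝ≥0 → Ω n → Equiv.Perm (Fin n))
    (hM : ∀ n, Mallows.IsMonotone (M n) (P n))
    (k : ℕ) (hk : 0 < k) :
    (haveI : IsProbabilityMeasure (gammaMeasure (k : ℝ) 1) :=
        isProbabilityMeasure_gammaMeasure (Nat.cast_pos.2 hk) one_pos;
      TendstoInDistribution (fun (n : ℕ) (ω : Ω n) => (n : ℝ) * Mallows.jumpTime (M n) k ω)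
        atTop (id : ℝ → ℝ) P (gammaMeasure (k : ℝ) 1)) ∧
    ((∀ n, Mallows.IsRegular (M n) (P n)) →
      ∀ (Ω' : Type*) [MeasurableSpace Ω'] (P' : Measure Ω') [IsProbabilityMeasure P']
        (N : Ω' → Set ℝ), Mallows.IsPoissonPointProcess N 1 P' →
        TendstoInDistribution
          (fun (n : ℕ) (ω : Ω n) (i : Fin k) => (n : ℝ) * Mallows.jumpTime (M n) ((i : ℕ) + 1) ω)
          atTop (fun (ω : Ω') (i : Fin k) => Mallows.nthPoint (N ω) ((i : ℕ) + 1)) P P') := by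
  have hmeas : ∀ (n i : ℕ),
      AEMeasurable (fun ω => (n : ℝ) * Mallows.jumpTime (M n) i ω) (P n) := fun n i =>
    ((hM n).aemeasurable_jumpTime i).const_mul _
  refine ⟨?_, fun hreg Ω' _ P' _ N hN => ?_⟩
  · have : IsProbabilityMeasure (gammaMeasure (k : ℝ) 1) :=
      isProbabilityMeasure_gammaMeasure (Nat.cast_pos.2 hk) one_pos
    refine Mallows.tendstoInDistribution_of_tendsto_Iic P _ _ (fun n => hmeas n k) fun c => ?_
    rw [← Mallows.poissonMeasure_Ici_eq_gammaMeasure k hk c]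
    refine (Mallows.tendsto_mallowsMeasure_le_inv c.toNNReal k).congr' ?_
    -- For `k < n` level `k` is attained almost surely, so the event is one about the law of `M` at
    -- the single time `c / n`.
    filter_upwards [eventually_gt_atTop k] with n hn
    rw [← (hM n).measure_mem]
    refine measure_congr ?_
    filter_upwards [(hM n).ae_natCast_mul_jumpTime_le_iff hk hn] with ω hω
    exact propext (hω c).symm
  · refine Mallows.tendstoInDistribution_of_increments P P' (fun i : Fin k => (i : ℕ) + 1)
      (fun n ω i => (n : ℝ) * Mallows.jumpTime (M n) ((i : ℕ) + 1) ω)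
      (fun n => aemeasurable_pi_lambda _ fun i => hmeas n _) _
      (aemeasurable_pi_lambda _ fun i => hN.aemeasurable_nthPoint (Nat.succ_pos _))
      (fun n s ω => Mallows.inv (M n (s / n) ω)) (fun s ω => Mallows.count (N ω) s)
      (fun n => ?_) hN.ae_count_zero ?_ ?_ fun m t ht _ A => ?_
    · filter_upwards [(hM n).ae_inv_zero] with ω hω
      rw [zero_div, hω]
    · filter_upwards [eventually_gt_atTop k] with n hn
      exact ae_all_iff.2 fun i => (hM n).ae_natCast_mul_jumpTime_le_iff (Nat.succ_pos _)
        (by have := i.2; omega)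
    · exact ae_all_iff.2 fun i => hN.ae_nthPoint_le_iff (Nat.succ_pos _)
    · rw [hN.measure_count_increments m t ht A]
      exact Mallows.tendsto_measure_inv_increments P M hreg m t ht A
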